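/- Let $r\ge 2$, with $\epsilon_1,\dots,\epsilon_r$ the standard basis of $\mathbb Z^r$ and $(\cdot,\cdot)$ the standard scalar product. Put $\alpha_i=\epsilon_i-\epsilon_{i+1}$ ($1\le i<r$), $\theta=\epsilon_1-\epsilon_r$, $\Phi=\{\epsilon_i-\epsilon_j\}_{i\neq j}$, and let $S_r$ permute coordinates. Let $n\ge 1$ be an integer and let $\mathbf Q:\mathbb Z^r\to\mathbb Q$ be a non-zero $S_r$-invariant quadratic form that is integral-valued on the root lattice $\mathbb Z\Phi$. Put $\mathbf B(\lambda,\mu)=\mathbf Q(\lambda+\mu)-\mathbf Q(\lambda)-\mathbf Q(\mu)$. Let $\kappa\in\mathbb Z$ be the common value of $\mathbf Q$ on $\Phi$, so that $\mathbf B(\lambda,\alpha)=\kappa(\lambda,\alpha)$ for $\alpha\in\Phi$. Put $\kappa'=\gcd(n,\kappa)$ and $m=n/\kappa'$. **Coefficients.** Let $\mathbb F=\mathbb C(q,k)$ and $\mathbb K^{(n)}=\mathbb F(g_i: 1\le i<n/2)$ with $q,k,g_i$ independent indeterminates, and fix a sign $\epsilon\in\{\pm1\}$. Put $g_0=-1$,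 $g_j=k^{-2}g_{n-j}^{-1}$ for $n/2<j<n$, $g_{n/2}=\epsilon^{-1}k^{-1}$ if $n$ is even, and extend $j\mapsto g_j$ to $\mathbb Z$ with period $n$. Let $\mathbb K^{(n,\kappa)}\subseteq\mathbb K^{(n)}$ be the subfield generated over $\mathbb F$ by the $g_{\kappa' j}$ with $1\le j<m/2$. For $\lambda\in\mathbb Z^r$ put $p_i(\lambda)=-k\,g_{-\mathbf B(\lambda,\alpha_i)}$ ($1\le i<r$) and $p_0(\lambda)=-k\,g_{\mathbf B(\lambda,\theta)}$; these lie in $\mathbb K^{(n,\kappa)}$. **Affine action.** Let $\sigma\tau(\nu)$ ($\sigma\in S_r$, $\nu\in m\mathbb Z^r$) act on $\mathbb Z^r\oplus\mathbb Z$ by $(v,c)\mapsto(\sigma v,c-(\nu,v))$. Put $s_i=s_{\alpha_i}$ for $1\le i<r$, $s_0=\tau(m\theta)s_\theta$, $\omega^{(m)}=s_1\cdots s_{r-1}\tau(m\epsilon_r)$, $b_i=(m\alpha_i,0)$ for $1\le i<r$, $b_0=(-m\theta,m^2)$. Write $x^{(v,c)}=q^cx^v$ and $x^{w\lambda}=x^{w(\lambda,0)}$;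 thus $x^{s_0\lambda}=q^{m(\lambda,\theta)}x^{s_\theta\lambda}$ and $x^{\omega^{(m)}\lambda}=q^{-m\lambda_r}x^{(\lambda_r,\lambda_1,\dots,\lambda_{r-1})}$. **Algebra.** The $\mathrm{GL}_r$ double affine Hecke algebra $\mathbb H^{(m)}$ is the unital associative $\mathbb F$-algebra generated by $T_0,\dots,T_{r-1}$, $\omega^{\pm1}$ and the algebra $\mathbb F[x^{\pm m}]=\mathbb F[x_1^{\pm m},\dots,x_r^{\pm m}]$, with the following defining relations, where indices are modulo $r$ and $\lambda\in m\mathbb Z^r$: the braid relations of type $\widehat A_{r-1}$ for $T_0,\dots,T_{r-1}$ (none if $r=2$); $(T_j-k)(T_j+k^{-1})=0$; $\omega\omega^{-1}=1=\omega^{-1}\omega$; $\omega T_j=T_{j+1}\omega$; and $$T_jx^\lambda-x^{s_j\lambda}T_j=(k-k^{-1})\frac{x^\lambda-x^{s_j\lambda}}{1-x^{b_j}},\qquad \omega x^\lambda=x^{\omega^{(m)}\lambda}\omega .$$ **Theorem.** For $s\in\mathbb Z$ let $t_m(s)=s-r_m(s)$, with $r_m(s)\in\{0,\dots,m-1\}$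 the remainder of $s$ modulo $m$, and for $\lambda\in\mathbb Z^r$ put $$\overline\nabla_i(x^\lambda)=\frac{1-x^{-t_m((\lambda,\alpha_i))\alpha_i}}{1-x^{m\alpha_i}}\,x^\lambda\quad(1\le i<r),\qquad \overline\nabla_0(x^\lambda)=\frac{1-q^{-m\,t_m(-(\lambda,\theta))}x^{t_m(-(\lambda,\theta))\theta}}{1-q^{m^2}x^{-m\theta}}\,x^\lambda .$$ The formulas $$\widehat\pi(T_j)x^\lambda=(k-k^{-1})\overline\nabla_j(x^\lambda)+p_j(\lambda)\,x^{s_j\lambda},\qquad \widehat\pi(x^\mu)x^\lambda=x^{\lambda+\mu},\qquad \widehat\pi(\omega)x^\lambda=x^{\omega^{(m)}\lambda}$$ for $0\le j<r$, $\mu\in m\mathbb Z^r$, $\lambda\in\mathbb Z^r$, turn $\mathbb K^{(n,\kappa)}[x_1^{\pm1},\dots,x_r^{\pm1}]$ into a left $\mathbb H^{(m)}$-module. That is, there is exactly one $\mathbb F$-algebra homomorphism $\widehat\pi$ from $\mathbb H^{(m)}$ to the $\mathbb K^{(n,\kappa)}$-linear endomorphisms of $\mathbb K^{(n,\kappa)}[x_1^{\pm1},\dots,x_r^{\pm1}]$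 satisfying these formulas. (This $\widehat\pi$ is called the metaplectic basic representation.) -/

import Mathlib

noncomputable section

namespace MetaDAHA

/-! ## Root data of type `A_{r-1}` and the affine Weyl group action

Coordinates of `ℤ^r` are indexed by `Fin r = {0, …, r-1}`, and so are the simple affine roots;
the index `j = 0` is the affine one and `j = 1, …, r-1` are the finite ones. Addition in `Fin r`
is modulo `r`. -/

/-- The standard basis vector `ε_{i+1}` of `ℤ^r`. -/
def eps {r : ℕ} (i : Fin r) : Fin r → ℤ := Pi.single i 1

/-- The last coordinate index. -/
def lastIdx (r : ℕ) [NeZero r] : Fin r := Fin.rev 0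

/-- The highest root `θ = ε_1 - ε_r`. -/
def theta (r : ℕ) [NeZero r] : Fin r → ℤ := eps 0 - eps (lastIdx r)

/-- The gradients of the simple affine roots (for `m = 1`): `-θ` for `j = 0`, and
`α_j = ε_j - ε_{j+1}` for `1 ≤ j < r` (in the zero-based indexing `eps (j-1) - eps j`). -/
def gradRoot {r : ℕ} [NeZero r] (j : Fin r) : Fin r → ℤ :=
  if j = 0 then -theta r else eps (j - 1) - eps j

/-- The root lattice, spanned by the roots `ε_i - ε_j`. -/
def rootLattice (r : ℕ) : AddSubgroup (Fin r → ℤ) :=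
  AddSubgroup.closure {γ | ∃ i j : Fin r, i ≠ j ∧ γ = eps i - eps j}

/-- The affine lattice `ℤ^r ⊕ ℤ`. -/
abbrev Aff (r : ℕ) : Type := (Fin r → ℤ) × ℤ

/-- The action of `σ τ(ν)` (`σ ∈ S_r`, `ν ∈ ℤ^r`) on `ℤ^r ⊕ ℤ`:
`(v, x) ↦ (σ v, x - (ν, v))`, where `σ ε_i = ε_{σ i}`. -/
def affAct {r : ℕ} (σ : Equiv.Perm (Fin r)) (ν : Fin r → ℤ) (v : Aff r) : Aff r :=
  (fun i => v.1 (σ⁻¹ i), v.2 - ν ⬝ᵥ v.1)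

/-- The action of the simple reflections `s_0^{(m)} = τ(mθ) s_θ` and `s_j = s_{α_j}`. -/
def simpleRefl {r : ℕ} [NeZero r] (m : ℕ) (j : Fin r) (v : Aff r) : Aff r :=
  if j = 0 then affAct 1 ((m : ℤ) • theta r) (affAct (Equiv.swap 0 (lastIdx r)) 0 v)
  else affAct (Equiv.swap (j - 1) j) 0 v

/-- The action of `ω^{(m)} = s_1 s_2 ⋯ s_{r-1} τ(m ε_r)`; the product `s_1 s_2 ⋯ s_{r-1}` is the
cycle `ε_1 ↦ ε_2 ↦ ⋯ ↦ ε_r ↦ ε_1`. -/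
def omegaAct {r : ℕ} [NeZero r] (m : ℕ) (v : Aff r) : Aff r :=
  affAct (finRotate r) ((m : ℤ) • eps (lastIdx r)) v

/-- The simple affine roots `b_0^{(m)} = (-mθ, m²)` and `b_j^{(m)} = (m α_j, 0)`. -/
def simpleRoot {r : ℕ} [NeZero r] (m : ℕ) (j : Fin r) : Aff r :=
  ((m : ℤ) • gradRoot j, if j = 0 then (m : ℤ) ^ 2 else 0)

/-- The sublattice `m ℤ^r` of `ℤ^r`. -/
def mLattice (r m : ℕ) : AddSubgroup (Fin r → ℤ) where
  carrier := {v | ∀ i, (m : ℤ) ∣ v i}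
  add_mem' ha hb i := dvd_add (ha i) (hb i)
  zero_mem' _ := dvd_zero _
  neg_mem' ha i := (dvd_neg).2 (ha i)

theorem simpleRefl_mem {r : ℕ} [NeZero r] (m : ℕ) (j : Fin r) {v : Aff r}
    (hv : v.1 ∈ mLattice r m) : (simpleRefl m j v).1 ∈ mLattice r m := by
  intro i
  unfold simpleRefl
  split_ifs
  · exact hv _
  · exact hv _

theorem omegaAct_mem {r : ℕ} [NeZero r] (m : ℕ) {v : Aff r}
    (hv : v.1 ∈ mLattice r m) : (omegaAct m v).1 ∈ mLattice r m := fun _ => hv _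

theorem simpleRoot_mem {r : ℕ} [NeZero r] (m : ℕ) (j : Fin r) :
    (simpleRoot m j).1 ∈ mLattice r m := fun _ => dvd_mul_right _ _

theorem string_mem {r : ℕ} [NeZero r] (m : ℕ) (j : Fin r) (v : mLattice r m) (i : ℤ) :
    (((v : Fin r → ℤ), (0 : ℤ)) + i • simpleRoot m j).1 ∈ mLattice r m :=
  add_mem v.2 (zsmul_mem (simpleRoot_mem m j) i)

/-! ## Quotients by `1 - Y` -/

/-- For a string `y i = Y^i * y 0` (`i ∈ ℤ`), this is the quotient
`(y 0 - y (-u)) / (1 - Y)`, written as a finite geometric sum. -/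
def geomQuot {A : Type*} [AddCommGroup A] (y : ℤ → A) (u : ℤ) : A :=
  ∑ i ∈ Finset.range (-u).toNat, y i - ∑ i ∈ Finset.range u.toNat, y (-((i : ℤ) + 1))

theorem geomQuot_spec {A : Type*} [Ring A] (Y : A) (y : ℤ → A)
    (h : ∀ i, Y * y i = y (i + 1)) (u : ℤ) :
    (1 - Y) * geomQuot y u = y 0 - y (-u) := by
  unfold geomQuot
  obtain ⟨n, rfl | rfl⟩ := Int.eq_nat_or_neg u
  · have h0 : (-(n : ℤ)).toNat = 0 := by omega
    rw [h0, Int.toNat_natCast, Finset.sum_range_zero, zero_sub]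
    induction n with
    | zero => simp
    | succ n ih =>
      rw [Finset.sum_range_succ, neg_add, mul_add, ih (by omega)]
      have := h (-((n : ℤ) + 1))
      rw [mul_neg, sub_mul, this, one_mul]
      have e1 : -((n : ℤ) + 1) + 1 = -(n : ℤ) := by ring
      rw [e1]
      push_cast
      abel
  · have h0 : (-(n : ℤ)).toNat = 0 := by omega
    rw [h0, neg_neg, Int.toNat_natCast, Finset.sum_range_zero, sub_zero]
    clear h0
    induction n with
    | zero => simp
    | succ n ih =>
      rw [Finset.sum_range_succ, mul_add, ih, sub_mul, one_mul, h]
      push_cast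
      abel

/-! ## The ground field `𝔽 = ℂ(q, k)` and Laurent polynomials -/

/-- The field `𝔽 = ℂ(q, k)`. -/
def BaseField : Type := FractionRing (MvPolynomial (Fin 2) ℂ)

instance : Field BaseField := inferInstanceAs (Field (FractionRing (MvPolynomial (Fin 2) ℂ)))

instance : Algebra (MvPolynomial (Fin 2) ℂ) BaseField :=
  inferInstanceAs (Algebra _ (FractionRing (MvPolynomial (Fin 2) ℂ)))

instance : IsFractionRing (MvPolynomial (Fin 2) ℂ) BaseField :=
  inferInstanceAs (IsFractionRing _ (FractionRing (MvPolynomial (Fin 2) ℂ)))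

/-- The indeterminate `q`. -/
def qVar : BaseField := algebraMap (MvPolynomial (Fin 2) ℂ) BaseField (MvPolynomial.X 0)

/-- The indeterminate `k`. -/
def kVar : BaseField := algebraMap (MvPolynomial (Fin 2) ℂ) BaseField (MvPolynomial.X 1)

theorem qVar_ne_zero : qVar ≠ 0 := by
  unfold qVar
  rw [Ne, IsFractionRing.to_map_eq_zero_iff]
  exact MvPolynomial.X_ne_zero 0

/-- Laurent polynomials `K[x_1^{±1}, …, x_r^{±1}]`, as the group algebra of `ℤ^r`. -/
abbrev Laurent (K : Type) [Field K] (r : ℕ) : Type := AddMonoidAlgebra K (Fin r → ℤ)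

/-- The element `x^{(λ, c)} = q^c x^λ` of `K[x^{±1}]`. -/
def mono (K : Type) [Field K] [Algebra BaseField K] {r : ℕ} (v : Aff r) : Laurent K r :=
  AddMonoidAlgebra.single v.1 (algebraMap BaseField K (qVar ^ v.2))

theorem mono_mul (K : Type) [Field K] [Algebra BaseField K] {r : ℕ} (v w : Aff r) :
    mono K v * mono K w = mono K (v + w) := by
  simp [mono, AddMonoidAlgebra.single_mul_single, zpow_add₀ qVar_ne_zero]

/-- Laurent polynomials `𝔽[x_1^{±m}, …, x_r^{±m}]`, as the group algebra of `m ℤ^r`. -/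
abbrev LaurentM (r m : ℕ) : Type := AddMonoidAlgebra BaseField (mLattice r m)

/-- The element `x^{(λ, c)} = q^c x^λ` of `𝔽[x^{±m}]`, for `λ ∈ m ℤ^r`. -/
def monoM {r m : ℕ} (v : Aff r) (hv : v.1 ∈ mLattice r m) : LaurentM r m :=
  AddMonoidAlgebra.single ⟨v.1, hv⟩ (qVar ^ v.2)

theorem monoM_mul {r m : ℕ} (v w : Aff r) (hv : v.1 ∈ mLattice r m) (hw : w.1 ∈ mLattice r m) :
    monoM v hv * monoM w hw = monoM (v + w) (add_mem hv hw) := by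
  simp [monoM, AddMonoidAlgebra.single_mul_single, zpow_add₀ qVar_ne_zero]

theorem monoM_congr {r m : ℕ} {v w : Aff r} (h : v = w) (hv : v.1 ∈ mLattice r m)
    (hw : w.1 ∈ mLattice r m) : monoM v hv = monoM w hw := by
  subst h; rfl

/-! ## Reflections through roots -/

theorem gradRoot_eq {r : ℕ} [NeZero r] (j : Fin r) :
    ∃ a b : Fin r, gradRoot j = eps a - eps b ∧ (2 ≤ r → a ≠ b) := by
  by_cases h : j = 0
  · refine ⟨lastIdx r, 0, by simp [gradRoot, h, theta], fun hr he => ?_⟩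
    have := congrArg Fin.val he
    simp [lastIdx, Fin.rev] at this
    omega
  · refine ⟨j - 1, j, by simp [gradRoot, h], fun hr he => ?_⟩
    have h1 : (1 : Fin r) = 0 := by simpa using he
    have := congrArg Fin.val h1
    rw [Fin.val_one', Fin.val_zero, Nat.mod_eq_of_lt (by omega)] at this
    omega

theorem dotProduct_eps_sub {r : ℕ} (v : Fin r → ℤ) (a b : Fin r) :
    v ⬝ᵥ (eps a - eps b) = v a - v b := by
  simp [eps, dotProduct_sub]

theorem perm_swap_eq {r : ℕ} (v : Fin r → ℤ) (a b : Fin r) :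
    (fun i => v ((Equiv.swap a b)⁻¹ i)) = v - (v ⬝ᵥ (eps a - eps b)) • (eps a - eps b) := by
  rw [dotProduct_eps_sub]
  funext i
  simp only [Equiv.swap_inv, Equiv.swap_apply_def, eps, Pi.sub_apply, Pi.smul_apply,
    Pi.single_apply, smul_eq_mul]
  split_ifs <;> subst_vars <;> simp_all

/-- For `λ ∈ m ℤ^r` the simple reflections are `s_j λ = λ - ((λ, α_j) / m) b_j`, with `α_0 = -θ`. -/
theorem simpleRefl_eq {r : ℕ} [NeZero r] (m : ℕ) (j : Fin r) (v : Fin r → ℤ)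
    (hv : v ∈ mLattice r m) :
    simpleRefl m j (v, 0) = (v, 0) + (-((v ⬝ᵥ gradRoot j) / (m : ℤ))) • simpleRoot m j := by
  have key : (m : ℤ) ∣ v ⬝ᵥ gradRoot j := by
    obtain ⟨a, b, h, -⟩ := gradRoot_eq j
    rw [h, dotProduct_eps_sub]
    exact dvd_sub (hv a) (hv b)
  have key' := Int.ediv_mul_cancel key
  set u := (v ⬝ᵥ gradRoot j) / (m : ℤ) with hu
  have hfirst : v + -u • (m : ℤ) • gradRoot j = v - (v ⬝ᵥ gradRoot j) • gradRoot j := by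
    rw [smul_smul, neg_mul, key', neg_smul, sub_eq_add_neg]
  by_cases h : j = 0
  · have hg : gradRoot j = -theta r := by simp [gradRoot, h]
    have hsw : (fun i => v ((Equiv.swap 0 (lastIdx r))⁻¹ i)) = v - (v ⬝ᵥ theta r) • theta r :=
      perm_swap_eq v 0 (lastIdx r)
    rw [hg] at key' hfirst
    simp only [simpleRefl, h, if_true, affAct, simpleRoot, hsw]
    have hg0 : gradRoot (0 : Fin r) = -theta r := by simp [gradRoot]
    ext1
    · simp only [Prod.fst_add, Prod.smul_fst, hg0]
      rw [hfirst, dotProduct_neg, neg_smul_neg]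
      rfl
    · simp only [Prod.snd_add, Prod.smul_snd, dotProduct_sub, dotProduct_smul, smul_dotProduct,
        zero_dotProduct, smul_eq_mul]
      by_cases hr : 2 ≤ r
      · have hne : (0 : Fin r) ≠ lastIdx r := by
          intro he
          have := congrArg Fin.val he
          simp [lastIdx, Fin.rev] at this
          omega
        have htt : theta r ⬝ᵥ theta r = 2 := by
          conv_lhs => rw [theta]
          rw [dotProduct_eps_sub]
          simp [eps, hne, hne.symm]
        rw [htt, dotProduct_comm (theta r) v]
        rw [dotProduct_neg] at key'
        have : v ⬝ᵥ theta r = -(u * m) := by linarith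
        rw [this]
        ring
      · have hz : theta r = 0 := by
          have : lastIdx r = 0 := by
            apply Fin.ext
            simp [lastIdx, Fin.rev]
            omega
          simp [theta, this]
        have : u = 0 := by simp [hu, hg, hz]
        simp [hz, this]
  · have hg : gradRoot j = eps (j - 1) - eps j := by simp [gradRoot, h]
    have hsw := perm_swap_eq v (j - 1) j
    rw [← hg] at hsw
    simp only [simpleRefl, h, if_false, affAct, simpleRoot, hsw]
    ext1
    · simp only [Prod.fst_add, Prod.smul_fst]
      rw [hfirst]
    · simp

/-! ## The `GL_r` double affine Hecke algebra `ℍ^{(m)}` -/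

/-- The divided difference `(x^λ - x^{s_j λ}) / (1 - x^{b_j})` in `𝔽[x^{±m}]`, for `λ ∈ m ℤ^r`;
see `divDiff_spec`. -/
def divDiff {r : ℕ} [NeZero r] (m : ℕ) (j : Fin r) (v : mLattice r m) : LaurentM r m :=
  geomQuot (fun i => monoM (((v : Fin r → ℤ), 0) + i • simpleRoot m j) (string_mem m j v i))
    (((v : Fin r → ℤ) ⬝ᵥ gradRoot j) / (m : ℤ))

theorem divDiff_spec {r : ℕ} [NeZero r] (m : ℕ) (j : Fin r) (v : mLattice r m) :
    (1 - monoM (simpleRoot m j) (simpleRoot_mem m j)) * divDiff m j v =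
      monoM ((v : Fin r → ℤ), 0) v.2 -
        monoM (simpleRefl m j ((v : Fin r → ℤ), 0)) (simpleRefl_mem m j v.2) := by
  unfold divDiff
  rw [geomQuot_spec]
  · congr 1
    · exact monoM_congr (by simp) _ _
    · exact monoM_congr (simpleRefl_eq m j v v.2).symm _ _
  · intro i
    rw [monoM_mul]
    exact monoM_congr (by rw [add_smul, one_smul]; abel) _ _

/-- Generators of the double affine Hecke algebra: `T_0, …, T_{r-1}`, `ω`, `ω⁻¹` and the elements
of the algebra `𝔽[x^{±m}]`. -/
inductive Gen (r m : ℕ) : Type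
  | T (j : Fin r)
  | om
  | omInv
  | X (f : LaurentM r m)

/-- The free `𝔽`-algebra on the generators. -/
abbrev FreeDAHA (r m : ℕ) : Type := FreeAlgebra BaseField (Gen r m)

/-- A generator, as an element of the free algebra. -/
abbrev gen {r m : ℕ} (g : Gen r m) : FreeDAHA r m := FreeAlgebra.ι BaseField g

/-- The defining relations of the double affine Hecke algebra. The first three say that
`𝔽[x^{±m}]` maps to the algebra by an `𝔽`-algebra homomorphism. -/
inductive Rel (r m : ℕ) [NeZero r] : FreeDAHA r m → FreeDAHA r m → Prop
  | X_scalar (c : BaseField) :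
      Rel r m (gen (.X (algebraMap BaseField (LaurentM r m) c))) (algebraMap BaseField _ c)
  | X_add (f g : LaurentM r m) : Rel r m (gen (.X (f + g))) (gen (.X f) + gen (.X g))
  | X_mul (f g : LaurentM r m) : Rel r m (gen (.X (f * g))) (gen (.X f) * gen (.X g))
  /- the braid relations of type `Â_{r-1}`, which are absent for `r = 2` -/
  | braid (j : Fin r) (hr : 3 ≤ r) :
      Rel r m (gen (.T j) * gen (.T (j + 1)) * gen (.T j))
        (gen (.T (j + 1)) * gen (.T j) * gen (.T (j + 1)))
  | comm (i j : Fin r) (hij : i ≠ j) (h1 : i ≠ j + 1) (h2 : j ≠ i + 1) :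
      Rel r m (gen (.T i) * gen (.T j)) (gen (.T j) * gen (.T i))
  | hecke (j : Fin r) :
      Rel r m ((gen (.T j) - algebraMap BaseField _ kVar) *
        (gen (.T j) + algebraMap BaseField _ kVar⁻¹)) 0
  | om_omInv : Rel r m (gen .om * gen .omInv) 1
  | omInv_om : Rel r m (gen .omInv * gen .om) 1
  | om_T (j : Fin r) : Rel r m (gen .om * gen (.T j)) (gen (.T (j + 1)) * gen .om)
  | cross_T (j : Fin r) (v : mLattice r m) :
      Rel r m
        (gen (.T j) * gen (.X (monoM ((v : Fin r → ℤ), 0) v.2)) -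
          gen (.X (monoM (simpleRefl m j ((v : Fin r → ℤ), 0)) (simpleRefl_mem m j v.2))) *
            gen (.T j))
        ((kVar - kVar⁻¹) • gen (.X (divDiff m j v)))
  | cross_om (v : mLattice r m) :
      Rel r m (gen .om * gen (.X (monoM ((v : Fin r → ℤ), 0) v.2)))
        (gen (.X (monoM (omegaAct m ((v : Fin r → ℤ), 0)) (omegaAct_mem m v.2))) * gen .om)

/-- The `GL_r` double affine Hecke algebra `ℍ^{(m)}` over `𝔽`. -/
abbrev DAHA (r m : ℕ) [NeZero r] : Type := RingQuot (Rel r m)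

/-- A generator, as an element of `ℍ^{(m)}`. -/
def DAHA.of {r m : ℕ} [NeZero r] (g : Gen r m) : DAHA r m :=
  RingQuot.mkAlgHom BaseField (Rel r m) (gen g)

/-! ## Metaplectic data and representation parameters -/

/-- Metaplectic data `(n, Q)`: a positive integer `n` and a non-zero `S_r`-invariant quadratic form
`Q : ℤ^r → ℚ` which is integral-valued on the root lattice. -/
structure MetaplecticData (r : ℕ) where
  n : ℕ
  n_pos : 0 < n
  Q : QuadraticMap ℤ (Fin r → ℤ) ℚ
  invariant : ∀ (σ : Equiv.Perm (Fin r)) (v : Fin r → ℤ), Q (fun i => v (σ⁻¹ i)) = Q v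
  integral : ∀ γ ∈ rootLattice r, ∃ z : ℤ, Q γ = z
  ne_zero : Q ≠ 0

/-- The field `𝕂^{(n)} = 𝔽(g_i : 1 ≤ i < n/2)` of rational functions over `𝔽`. -/
def ParamField (n : ℕ) : Type :=
  FractionRing (MvPolynomial {i : ℕ // 0 < i ∧ 2 * i < n} BaseField)

instance (n : ℕ) : Field (ParamField n) :=
  inferInstanceAs (Field (FractionRing (MvPolynomial {i : ℕ // 0 < i ∧ 2 * i < n} BaseField)))

instance (n : ℕ) : Algebra (MvPolynomial {i : ℕ // 0 < i ∧ 2 * i < n} BaseField) (ParamField n) :=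
  inferInstanceAs
    (Algebra _ (FractionRing (MvPolynomial {i : ℕ // 0 < i ∧ 2 * i < n} BaseField)))

instance (n : ℕ) :
    IsFractionRing (MvPolynomial {i : ℕ // 0 < i ∧ 2 * i < n} BaseField) (ParamField n) :=
  inferInstanceAs
    (IsFractionRing _ (FractionRing (MvPolynomial {i : ℕ // 0 < i ∧ 2 * i < n} BaseField)))

instance (n : ℕ) : Algebra BaseField (ParamField n) :=
  inferInstanceAs
    (Algebra BaseField (FractionRing (MvPolynomial {i : ℕ // 0 < i ∧ 2 * i < n} BaseField)))

instance (n : ℕ) : IsScalarTower BaseField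
    (MvPolynomial {i : ℕ // 0 < i ∧ 2 * i < n} BaseField) (ParamField n) :=
  inferInstanceAs (IsScalarTower BaseField _
    (FractionRing (MvPolynomial {i : ℕ // 0 < i ∧ 2 * i < n} BaseField)))

/-- The indeterminate `g_i`, `1 ≤ i < n/2`. -/
def gVar {n : ℕ} (i : {i : ℕ // 0 < i ∧ 2 * i < n}) : ParamField n :=
  algebraMap (MvPolynomial {i : ℕ // 0 < i ∧ 2 * i < n} BaseField) (ParamField n)
    (MvPolynomial.X i)

/-- The representation parameters `g_j^{(n)}` for `0 ≤ j < n`, with sign `e ∈ {±1}`. -/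
def gNat (n : ℕ) (e : ℤˣ) (j : ℕ) : ParamField n :=
  if j = 0 then -1
  else if 2 * j = n then algebraMap BaseField (ParamField n) ((((e : ℤ) : BaseField))⁻¹ * kVar⁻¹)
  else if h : 0 < j ∧ 2 * j < n then gVar ⟨j, h⟩
  else if h : 0 < n - j ∧ 2 * (n - j) < n then
    algebraMap BaseField (ParamField n) (kVar ^ (-2 : ℤ)) * (gVar ⟨n - j, h⟩)⁻¹
  else 0 -- does not occur for `0 ≤ j < n`

/-- The representation parameters `g_j^{(n)}`, `j ∈ ℤ`, extended `n`-periodically. -/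
def gPar (n : ℕ) (e : ℤˣ) (j : ℤ) : ParamField n := gNat n e (j % (n : ℤ)).toNat

namespace MetaplecticData

variable {r : ℕ}

/-- The symmetric bilinear form `B(λ, μ) = Q(λ + μ) - Q(λ) - Q(μ)`. -/
def B (D : MetaplecticData r) (v w : Fin r → ℤ) : ℚ := D.Q (v + w) - D.Q v - D.Q w

/-- The integer `κ = Q(α)`, the common value of `Q` on the roots (see `Q_root`); here it is read
off at `θ`, and the floor converts the integral rational number `Q(θ)` into an integer. -/
def kappa [NeZero r] (D : MetaplecticData r) : ℤ := ⌊D.Q (theta r)⌋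

/-- `κ' = gcd(n, κ)`. -/
def kappa' [NeZero r] (D : MetaplecticData r) : ℕ := Int.gcd D.n D.kappa

/-- `m = n / gcd(n, κ)`. -/
def m [NeZero r] (D : MetaplecticData r) : ℕ := D.n / D.kappa'

theorem kappa'_pos [NeZero r] (D : MetaplecticData r) : 0 < D.kappa' :=
  Int.gcd_pos_of_ne_zero_left _ (by exact_mod_cast D.n_pos.ne')

theorem kappa'_mul_m [NeZero r] (D : MetaplecticData r) : D.kappa' * D.m = D.n :=
  Nat.mul_div_cancel' (by
    have : ((D.kappa' : ℕ) : ℤ) ∣ (D.n : ℤ) := Int.gcd_dvd_left _ _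
    exact_mod_cast this)

theorem m_pos [NeZero r] (D : MetaplecticData r) : 0 < D.m := by
  rcases Nat.eq_zero_or_pos D.m with h | h
  · have := D.kappa'_mul_m
    rw [h, mul_zero] at this
    exact absurd this.symm D.n_pos.ne'
  · exact h

theorem Q_eps_sub (D : MetaplecticData r) {a b c d : Fin r} (hab : a ≠ b) (hcd : c ≠ d) :
    D.Q (eps a - eps b) = D.Q (eps c - eps d) := by
  obtain ⟨σ, h1, h2⟩ : ∃ σ : Equiv.Perm (Fin r), σ c = a ∧ σ d = b := by
    refine ⟨(Equiv.swap c a).trans (Equiv.swap (Equiv.swap c a d) b), ?_, ?_⟩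
    · rw [Equiv.trans_apply, Equiv.swap_apply_left]
      refine Equiv.swap_apply_of_ne_of_ne (fun h => hcd ?_) hab
      apply (Equiv.swap c a).injective
      rw [Equiv.swap_apply_left]
      exact h
    · simp
  rw [← D.invariant σ (eps c - eps d)]
  congr 1
  funext i
  simp only [eps, Pi.sub_apply, Pi.single_apply, Equiv.Perm.inv_eq_iff_eq, h1, h2]

theorem Q_root [NeZero r] (D : MetaplecticData r) {a b : Fin r} (hab : a ≠ b) :
    D.Q (eps a - eps b) = D.kappa := by
  have hr : 2 ≤ r := by
    have h1 := a.isLt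
    have h2 := b.isLt
    have h3 : (a : ℕ) ≠ b := fun h => hab (Fin.ext h)
    omega
  have hne : (0 : Fin r) ≠ lastIdx r := by
    intro he
    have := congrArg Fin.val he
    simp [lastIdx, Fin.rev] at this
    omega
  have hth : D.Q (theta r) = D.kappa := by
    obtain ⟨z, hz⟩ := D.integral (theta r)
      (AddSubgroup.subset_closure ⟨0, lastIdx r, hne, rfl⟩)
    rw [kappa, hz, Int.floor_intCast]
  rw [← hth]
  exact D.Q_eps_sub hab hne

/-- `B(λ, α) = κ (λ, α)` for `λ ∈ ℤ^r` and every root `α`. -/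
theorem B_root [NeZero r] (D : MetaplecticData r) (v : Fin r → ℤ) {a b : Fin r} (hab : a ≠ b) :
    D.B v (eps a - eps b) = ((D.kappa * (v ⬝ᵥ (eps a - eps b)) : ℤ) : ℚ) := by
  set α : Fin r → ℤ := eps a - eps b with hα
  have hB : ∀ w, D.B w α = QuadraticMap.polar D.Q w α := fun w => rfl
  have hs : (fun i => v ((Equiv.swap a b)⁻¹ i)) = v - (v ⬝ᵥ α) • α := perm_swap_eq v a b
  have hsα : (fun i => α ((Equiv.swap a b)⁻¹ i)) = -α := by
    rw [perm_swap_eq, dotProduct_eps_sub]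
    have : α a - α b = 2 := by simp [hα, eps, hab, hab.symm]
    rw [this, ← hα]
    rw [two_smul]
    abel
  have hinv : QuadraticMap.polar D.Q (v - (v ⬝ᵥ α) • α) (-α) = QuadraticMap.polar D.Q v α := by
    rw [← hs, ← hsα]
    simp only [QuadraticMap.polar]
    rw [D.invariant, D.invariant]
    congr 2
    exact D.invariant (Equiv.swap a b) (v + α)
  rw [QuadraticMap.polar_neg_right, QuadraticMap.polar_sub_left, QuadraticMap.polar_smul_left,
    QuadraticMap.polar_self, D.Q_root hab] at hinv
  rw [hB]
  simp only [zsmul_eq_mul, nsmul_eq_mul] at hinv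
  push_cast at hinv ⊢
  linarith

/-- The functions `p_j^{(n,κ)}`: `p_j(λ) = -k g_{-B(λ, α_j)}` for `1 ≤ j < r` and
`p_0(λ) = -k g_{B(λ, θ)}`. The rational numbers `B(λ, α)` are integers by `B_root`. -/
def pVal [NeZero r] (D : MetaplecticData r) (e : ℤˣ) (j : Fin r) (v : Fin r → ℤ) :
    ParamField D.n :=
  if j = 0 then -(algebraMap BaseField (ParamField D.n) kVar * gPar D.n e ⌊D.B v (theta r)⌋)
  else -(algebraMap BaseField (ParamField D.n) kVar *
    gPar D.n e (-⌊D.B v (eps (j - 1) - eps j)⌋))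

/-- The field `𝕂^{(n,κ)}`, generated over `𝔽` by the `g_{κ' j}^{(n)}` with `1 ≤ j < m/2`. -/
def coeffField [NeZero r] (D : MetaplecticData r) (e : ℤˣ) :
    IntermediateField BaseField (ParamField D.n) :=
  IntermediateField.adjoin BaseField
    {g | ∃ j : ℕ, 1 ≤ j ∧ 2 * j < D.m ∧ g = gPar D.n e ((D.kappa' * j : ℕ) : ℤ)}

theorem gPar_mem [NeZero r] (D : MetaplecticData r) (e : ℤˣ) (s : ℤ) :
    gPar D.n e (D.kappa * s) ∈ D.coeffField e := by
  obtain ⟨u, hu⟩ : ((D.kappa' : ℕ) : ℤ) ∣ D.kappa := Int.gcd_dvd_right _ _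
  have hn := D.kappa'_mul_m
  have hk := D.kappa'_pos
  have hm := D.m_pos
  obtain ⟨j, hj⟩ : ∃ j : ℕ, (u * s) % (D.m : ℤ) = j :=
    ⟨((u * s) % (D.m : ℤ)).toNat,
      (Int.toNat_of_nonneg (Int.emod_nonneg _ (by exact_mod_cast hm.ne'))).symm⟩
  have hjm : j < D.m := by
    have := Int.emod_lt_of_pos (u * s) (show (0 : ℤ) < D.m by exact_mod_cast hm)
    rw [hj] at this
    exact_mod_cast this
  have hmod : (D.kappa * s) % (D.n : ℤ) = ((D.kappa' * j : ℕ) : ℤ) := by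
    rw [hu, ← hn]
    push_cast
    rw [mul_assoc, Int.mul_emod_mul_of_pos _ _ (by exact_mod_cast hk), hj]
  have small : ∀ i : ℕ, i < D.m →
      gPar D.n e ((D.kappa' * i : ℕ) : ℤ) = gNat D.n e (D.kappa' * i) := by
    intro i hi
    have : D.kappa' * i < D.n := by rw [← hn]; exact Nat.mul_lt_mul_of_pos_left hi hk
    rw [gPar, Int.emod_eq_of_lt (by positivity) (by exact_mod_cast this), Int.toNat_natCast]
  have hval : gPar D.n e (D.kappa * s) = gNat D.n e (D.kappa' * j) := by
    rw [gPar, hmod, Int.toNat_natCast]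
  have hgen : ∀ i : ℕ, 1 ≤ i → 2 * i < D.m → gNat D.n e (D.kappa' * i) ∈ D.coeffField e := by
    intro i h1 h2
    rw [← small i (by omega)]
    exact IntermediateField.subset_adjoin _ _ ⟨i, h1, h2, rfl⟩
  rw [hval]
  rcases Nat.eq_zero_or_pos j with rfl | hj0
  · simp only [gNat, mul_zero, if_true]
    exact neg_mem (one_mem _)
  rcases lt_trichotomy (2 * j) D.m with h | h | h
  · exact hgen j hj0 h
  · have h1 : D.kappa' * j ≠ 0 := (Nat.mul_pos hk hj0).ne'
    have h2 : 2 * (D.kappa' * j) = D.n := by rw [← hn, ← h]; ring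
    rw [gNat, if_neg h1, if_pos h2]
    exact IntermediateField.algebraMap_mem _ _
  · have h1 : D.kappa' * j ≠ 0 := (Nat.mul_pos hk hj0).ne'
    have h2 : D.n < 2 * (D.kappa' * j) := by
      rw [← hn]
      calc D.kappa' * D.m < D.kappa' * (2 * j) := Nat.mul_lt_mul_of_pos_left h hk
        _ = 2 * (D.kappa' * j) := by ring
    have h3 : D.kappa' * j < D.n := by rw [← hn]; exact Nat.mul_lt_mul_of_pos_left hjm hk
    have h4 : D.n - D.kappa' * j = D.kappa' * (D.m - j) := by rw [Nat.mul_sub, hn]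
    have h5 := hgen (D.m - j) (by omega) (by omega)
    rw [← h4] at h5
    have h6 : 0 < D.n - D.kappa' * j ∧ 2 * (D.n - D.kappa' * j) < D.n := by omega
    rw [gNat, if_neg (by omega), if_neg (by omega), dif_pos h6] at h5
    rw [gNat, if_neg h1, if_neg (by omega), dif_neg (by omega), dif_pos h6]
    exact mul_mem (IntermediateField.algebraMap_mem _ _) (inv_mem h5)

theorem pVal_mem [NeZero r] (D : MetaplecticData r) (hr : 2 ≤ r) (e : ℤˣ) (j : Fin r)
    (v : Fin r → ℤ) : D.pVal e j v ∈ D.coeffField e := by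
  obtain ⟨a, b, hg, hab⟩ := gradRoot_eq j
  unfold pVal
  split_ifs with h
  · have h1 : theta r = eps b - eps a := by
      have : gradRoot j = -theta r := by simp [gradRoot, h]
      rw [this] at hg
      rw [← neg_neg (theta r), hg, neg_sub]
    rw [h1, D.B_root v (hab hr).symm, Int.floor_intCast]
    exact neg_mem (mul_mem (IntermediateField.algebraMap_mem _ _) (D.gPar_mem e _))
  · have h1 : eps (j - 1) - eps j = eps a - eps b := by
      rw [← hg]
      simp [gradRoot, h]
    rw [h1, D.B_root v (hab hr), Int.floor_intCast,
      show -(D.kappa * (v ⬝ᵥ (eps a - eps b))) = D.kappa * -(v ⬝ᵥ (eps a - eps b)) by ring]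
    exact neg_mem (mul_mem (IntermediateField.algebraMap_mem _ _) (D.gPar_mem e _))

/-- `𝕂^{(n,κ)}` as a type. -/
def Coeff [NeZero r] (D : MetaplecticData r) (e : ℤˣ) : Type := ↥(D.coeffField e)

instance [NeZero r] (D : MetaplecticData r) (e : ℤˣ) : Field (D.Coeff e) :=
  inferInstanceAs (Field ↥(D.coeffField e))

instance [NeZero r] (D : MetaplecticData r) (e : ℤˣ) : Algebra BaseField (D.Coeff e) :=
  inferInstanceAs (Algebra BaseField ↥(D.coeffField e))

/-- `p_j^{(n,κ)}` as a function with values in `𝕂^{(n,κ)}`. -/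
def p [NeZero r] (D : MetaplecticData r) (hr : 2 ≤ r) (e : ℤˣ) (j : Fin r) (v : Fin r → ℤ) :
    D.Coeff e := ⟨D.pVal e j v, D.pVal_mem hr e j v⟩

end MetaplecticData

/-! ## The metaplectic divided differences -/

/-- `t_m(s) = s - r_m(s)`, with `r_m(s) ∈ {0, …, m-1}` the remainder of `s` modulo `m`. -/
def tRem (m : ℕ) (s : ℤ) : ℤ := s - s % (m : ℤ)

/-- The value at `x^λ` of the metaplectic divided difference operator on `K[x^{±1}]`:
`(1 - x^{-t_m((λ, α_j)) α_j}) / (1 - x^{m α_j}) * x^λ` for `j ≥ 1`, and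
`(1 - q^{-m t} x^{t θ}) / (1 - q^{m²} x^{-mθ}) * x^λ` with `t = t_m(-(λ, θ))` for `j = 0`;
see `metaDiff_spec` and `metaDiff_spec_zero`. -/
def metaDiff (K : Type) [Field K] [Algebra BaseField K] {r : ℕ} [NeZero r] (m : ℕ) (j : Fin r)
    (v : Fin r → ℤ) : Laurent K r :=
  geomQuot (fun i => mono K ((v, 0) + i • simpleRoot m j))
    (tRem m (v ⬝ᵥ gradRoot j) / (m : ℤ))

theorem metaDiff_aux (K : Type) [Field K] [Algebra BaseField K] {r : ℕ} [NeZero r] (m : ℕ)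
    (j : Fin r) (v : Fin r → ℤ) :
    (1 - mono K (simpleRoot m j)) * metaDiff K m j v =
      (1 - mono K ((-(tRem m (v ⬝ᵥ gradRoot j) / (m : ℤ))) • simpleRoot m j)) * mono K (v, 0) := by
  unfold metaDiff
  rw [geomQuot_spec, sub_mul, one_mul, mono_mul]
  · congr 2
    · simp
    · rw [add_comm]
  · intro i
    rw [mono_mul]
    congr 1
    rw [add_smul, one_smul]
    abel

theorem tRem_div_mul (m : ℕ) (s : ℤ) : tRem m s / (m : ℤ) * (m : ℤ) = tRem m s :=
  Int.ediv_mul_cancel (Int.dvd_self_sub_emod)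

theorem metaDiff_spec (K : Type) [Field K] [Algebra BaseField K] {r : ℕ} [NeZero r] (m : ℕ)
    (j : Fin r) (hj : j ≠ 0) (v : Fin r → ℤ) :
    (1 - mono K ((m : ℤ) • (eps (j - 1) - eps j), 0)) * metaDiff K m j v =
      (1 - mono K (-tRem m (v ⬝ᵥ (eps (j - 1) - eps j)) • (eps (j - 1) - eps j), 0)) *
        mono K (v, 0) := by
  have h := metaDiff_aux K m j v
  have hg : gradRoot j = eps (j - 1) - eps j := by simp [gradRoot, hj]
  have hb : simpleRoot m j = ((m : ℤ) • (eps (j - 1) - eps j), 0) := by simp [simpleRoot, hj, hg]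
  rw [hb, hg] at h
  rw [h, Prod.smul_mk, smul_smul, neg_mul, tRem_div_mul, smul_zero]

theorem metaDiff_spec_zero (K : Type) [Field K] [Algebra BaseField K] {r : ℕ} [NeZero r] (m : ℕ)
    (v : Fin r → ℤ) :
    (1 - mono K (-((m : ℤ) • theta r), (m : ℤ) ^ 2)) * metaDiff K m 0 v =
      (1 - mono K (tRem m (-(v ⬝ᵥ theta r)) • theta r, -(m * tRem m (-(v ⬝ᵥ theta r))))) *
        mono K (v, 0) := by
  have h := metaDiff_aux K m 0 v
  have hg : gradRoot (0 : Fin r) = -theta r := by simp [gradRoot]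
  have hb : simpleRoot m (0 : Fin r) = (-((m : ℤ) • theta r), (m : ℤ) ^ 2) := by
    simp [simpleRoot, hg]
  rw [hb, hg, dotProduct_neg] at h
  rw [h, Prod.smul_mk]
  have ht := tRem_div_mul m (-(v ⬝ᵥ theta r))
  congr 4
  · rw [smul_neg, neg_smul, neg_neg, smul_smul, ht]
  · rw [smul_eq_mul, ← ht]
    simp only [tRem_div_mul]
    linear_combination (-(m : ℤ)) * ht

end MetaDAHA

end

noncomputable section

namespace MetaDAHA

/-! ## Affine root combinatorics -/

section Affine

variable {r : ℕ} [NeZero r]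

/-! The parameters enter only through a function `P` with p_j(λ) = P((λ, α_j)), where α_0 = -θ. All
that is used of `P` is that it has period m, that P(0) = k, and that P(s) P(-s) = 1 when m does not
divide s (`isParam_param`). For any such `P` the operators satisfy the defining relations.

The cross relations (`opT_mono_mul`) follow by clearing the denominator 1 - x^{b_j}: adding a
multiple of m to (λ, α_j) shifts t_m by the same multiple and leaves `P` unchanged. The operator ω
sends the data of index j to those of index j + 1 (`opOm_mul_opT`), so relations involving the
affine index 0 follow from relations among finite indices.

For finite indices, let Z be the difference of the two sides of a quadratic, braid or commutation
relation. The cross relations alone show that Z carries multiplication by each x_i^m to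
multiplication by some x_{i'}^m. Hence Z = 0 as soon as Z kills the monomials with all exponents in
[0, m) (`eq_zero_of_intertwining`). On these, T_j either exchanges two exponents up to a scalar or
adds one diagonal term, according to their order. What remains is a finite check on the monomials
obtained by permuting two or three exponents (`hecke_box`, `braid_box`), or a direct expansion for
commuting reflections.

Uniqueness holds because the formulas fix the images of T_j, x^μ and ω on a basis, and ω⁻¹ must go
to the inverse of the image of ω (`DAHA.algHom_ext`). -/

theorem lastIdx_eq : lastIdx r = 0 - 1 := by
  obtain ⟨n, rfl⟩ := Nat.exists_eq_succ_of_ne_zero (NeZero.ne r)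
  rw [zero_sub, eq_neg_iff_add_eq_zero]
  have : lastIdx (n + 1) = Fin.last n := by simp [lastIdx]
  rw [show lastIdx n.succ = Fin.last n from this]
  exact Fin.last_add_one n

/-- With indices read modulo r, -θ = ε_r - ε_1 fits the pattern of the other simple roots, so the
affine index needs no separate treatment. -/
theorem gradRoot_eq_sub (j : Fin r) : gradRoot j = eps (j - 1) - eps j := by
  by_cases h : j = 0
  · subst h; simp [gradRoot, theta, lastIdx_eq]
  · simp [gradRoot, h]

theorem dotProduct_gradRoot (v : Fin r → ℤ) (j : Fin r) :
    v ⬝ᵥ gradRoot j = v (j - 1) - v j := by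
  rw [gradRoot_eq_sub, dotProduct_eps_sub]

/-- The affine root `(α_j, δ_{j,0} m)`, of which `simpleRoot m j` is the `m`-th multiple. -/
def unitRoot (m : ℕ) (j : Fin r) : Aff r := (gradRoot j, if j = 0 then (m : ℤ) else 0)

theorem simpleRoot_eq_smul (m : ℕ) (j : Fin r) : simpleRoot m j = (m : ℤ) • unitRoot m j := by
  by_cases h : j = 0 <;> simp [simpleRoot, unitRoot, h, pow_two]

theorem one_ne_zero_fin (hr : 2 ≤ r) : (1 : Fin r) ≠ 0 := by
  intro h
  have := congrArg Fin.val h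
  rw [Fin.val_one', Fin.val_zero, Nat.mod_eq_of_lt (by omega)] at this
  omega

theorem sub_one_ne (hr : 2 ≤ r) (j : Fin r) : j - 1 ≠ j := by
  simpa using one_ne_zero_fin hr

theorem gradRoot_dotProduct_self (hr : 2 ≤ r) (j : Fin r) : gradRoot j ⬝ᵥ gradRoot j = 2 := by
  have h := sub_one_ne hr j
  rw [dotProduct_gradRoot, gradRoot_eq_sub]
  simp [eps, h, h.symm]

/-- Dividing b_j by m gives a reflection formula on the whole affine lattice, with no divisibility
condition. For the affine index, the second coordinate comes out right because (θ, θ) = 2. -/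
theorem simpleRefl_eq_sub (hr : 2 ≤ r) (m : ℕ) (j : Fin r) (w : Aff r) :
    simpleRefl m j w = w - (w.1 ⬝ᵥ gradRoot j) • unitRoot m j := by
  obtain ⟨v, c⟩ := w
  by_cases h : j = 0
  · subst h
    have hg : theta r = -gradRoot (0 : Fin r) := by simp [gradRoot]
    have hsw : (fun i => v ((Equiv.swap 0 (lastIdx r))⁻¹ i)) = v - (v ⬝ᵥ theta r) • theta r :=
      perm_swap_eq v 0 (lastIdx r)
    have h2 := gradRoot_dotProduct_self hr 0
    simp only [simpleRefl, if_true, affAct, hsw, unitRoot]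
    ext1
    · change v - (v ⬝ᵥ theta r) • theta r = v - (v ⬝ᵥ gradRoot (0 : Fin r)) • gradRoot (0 : Fin r)
      simp [hg]
    · simp only [hg, smul_dotProduct, dotProduct_sub, dotProduct_smul, neg_dotProduct,
        dotProduct_neg, h2, zero_dotProduct, Prod.snd_sub, Prod.smul_snd, smul_eq_mul,
        dotProduct_comm (gradRoot 0) v, neg_smul_neg]
      ring
  · have hsw := perm_swap_eq v (j - 1) j
    rw [← gradRoot_eq_sub] at hsw
    simp only [simpleRefl, h, if_false, affAct, hsw, unitRoot]
    ext1 <;> simp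

theorem simpleRefl_add (hr : 2 ≤ r) (m : ℕ) (j : Fin r) (v w : Aff r) :
    simpleRefl m j (v + w) = simpleRefl m j v + simpleRefl m j w := by
  simp only [simpleRefl_eq_sub hr, Prod.fst_add, add_dotProduct, add_smul]
  abel

/-- For `j ≠ 0` the reflection `s_j` swaps two coordinates. -/
theorem simpleRefl_of_ne (m : ℕ) {j : Fin r} (hj : j ≠ 0) (v : Fin r → ℤ) :
    simpleRefl m j (v, 0) = (v ∘ Equiv.swap (j - 1) j, 0) := by
  simp only [simpleRefl, hj, if_false, affAct]
  ext1
  · funext i; simp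
  · simp

theorem omegaAct_add (m : ℕ) (v w : Aff r) :
    omegaAct m (v + w) = omegaAct m v + omegaAct m w := by
  ext1
  · rfl
  · simp only [omegaAct, affAct, Prod.fst_add, Prod.snd_add, dotProduct_add]; ring

/-- `ω^{(m)}` as an additive map. -/
def omegaHom (r m : ℕ) [NeZero r] : Aff r →+ Aff r :=
  AddMonoidHom.mk' (omegaAct m) (omegaAct_add m)

theorem omegaAct_fst (m : ℕ) (w : Aff r) (i : Fin r) : (omegaAct m w).1 i = w.1 (i - 1) := by
  simp [omegaAct, affAct]

theorem omegaAct_snd (m : ℕ) (w : Aff r) : (omegaAct m w).2 = w.2 - m * w.1 (0 - 1) := by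
  rw [omegaAct, affAct, smul_dotProduct, eps, single_one_dotProduct, lastIdx_eq, smul_eq_mul]

theorem omegaAct_dotProduct (m : ℕ) (w : Aff r) (j : Fin r) :
    (omegaAct m w).1 ⬝ᵥ gradRoot (j + 1) = w.1 ⬝ᵥ gradRoot j := by
  simp only [dotProduct_gradRoot, omegaAct_fst, add_sub_cancel_right]

/-- ω lowers the second coordinate by m times the last entry. For r ≥ 2 that entry is 1 at j = 0,
which cancels the m carried by the affine root, and -1 at j + 1 = 0, which creates it again. -/
theorem omegaAct_unitRoot (m : ℕ) (j : Fin r) :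
    omegaAct m (unitRoot m j) = unitRoot m (j + 1) := by
  ext1
  · funext i
    rw [omegaAct_fst]
    simp only [unitRoot, gradRoot_eq_sub, eps, Pi.sub_apply, Pi.single_apply,
      add_sub_cancel_right, sub_eq_iff_eq_add, sub_add_cancel]
  · rw [omegaAct_snd]
    have h1 : (0 - 1 = j) ↔ (j + 1 = 0) := by
      rw [zero_sub, eq_comm, eq_neg_iff_add_eq_zero]
    simp only [unitRoot, gradRoot_eq_sub, eps, Pi.sub_apply, Pi.single_apply, sub_left_inj, h1,
      eq_comm (a := (0 : Fin r)) (b := j)]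
    split_ifs <;> simp

theorem omegaAct_simpleRoot (m : ℕ) (j : Fin r) :
    omegaAct m (simpleRoot m j) = simpleRoot m (j + 1) := by
  rw [simpleRoot_eq_smul, simpleRoot_eq_smul, ← omegaAct_unitRoot]
  exact map_zsmul (omegaHom r m) _ _

theorem omegaAct_simpleRefl (hr : 2 ≤ r) (m : ℕ) (j : Fin r) (w : Aff r) :
    omegaAct m (simpleRefl m j w) = simpleRefl m (j + 1) (omegaAct m w) := by
  rw [simpleRefl_eq_sub hr, simpleRefl_eq_sub hr, omegaAct_dotProduct, ← omegaAct_unitRoot]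
  exact (map_sub (omegaHom r m) _ _).trans (congrArg _ (map_zsmul (omegaHom r m) _ _))

/-- The inverse of `ω^{(m)}`. -/
def omegaInvAct (m : ℕ) (w : Aff r) : Aff r := (fun i => w.1 (i + 1), w.2 + m * w.1 0)

theorem omegaAct_omegaInvAct (m : ℕ) (w : Aff r) : omegaAct m (omegaInvAct m w) = w := by
  ext1
  · funext i; simp [omegaAct_fst, omegaInvAct]
  · simp [omegaAct_snd, omegaInvAct]

theorem omegaInvAct_omegaAct (m : ℕ) (w : Aff r) : omegaInvAct m (omegaAct m w) = w := by
  ext1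
  · funext i; simp [omegaAct_fst, omegaInvAct]
  · simp [omegaAct_fst, omegaAct_snd, omegaInvAct]

end Affine

/-! ## Linear maps on Laurent polynomials -/

section Lin

variable {K : Type} [Field K] [Algebra BaseField K] {r : ℕ}

theorem mono_zero : mono K (0 : Aff r) = 1 := by
  simp [mono, AddMonoidAlgebra.one_def]

theorem mono_eq_smul (v : Fin r → ℤ) (c : ℤ) :
    mono K (v, c) = algebraMap BaseField K (qVar ^ c) • mono K (v, 0) := by
  simp [mono]

theorem hom_ext_mono {V : Type*} [AddCommMonoid V] [Module K V] {f g : Laurent K r →ₗ[K] V}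
    (h : ∀ v : Fin r → ℤ, f (mono K (v, 0)) = g (mono K (v, 0))) : f = g := by
  apply AddMonoidAlgebra.lhom_ext'
  intro v
  ext
  simpa [mono] using h v

/-- The linear map with prescribed values on monomials. -/
def lin {V : Type*} [AddCommMonoid V] [Module K V] (f : (Fin r → ℤ) → V) :
    Laurent K r →ₗ[K] V :=
  Finsupp.lift V K _ f ∘ₗ (AddMonoidAlgebra.coeffLinearEquiv K).toLinearMap

theorem lin_mono {V : Type*} [AddCommMonoid V] [Module K V] (f : (Fin r → ℤ) → V)
    (v : Fin r → ℤ) : lin (K := K) f (mono K (v, 0)) = f v := by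
  simp [lin, mono]

theorem mono_injective {v w : Aff r} (h : mono K v = mono K w) : v.1 = w.1 := by
  have hq (c : ℤ) : algebraMap BaseField K (qVar ^ c) ≠ 0 := by
    rw [Ne, map_eq_zero]; exact zpow_ne_zero _ qVar_ne_zero
  by_contra hne
  have := congrArg (fun f => f.coeff v.1) h
  simp [mono, Ne.symm hne] at this
  exact hq v.2 (by simpa using this)

/-- Pairing b_j = 0 with α_j would give 2m = 0. Laurent polynomials have no zero divisors, so
identities between divided differences may be checked after multiplying by this factor. -/
theorem one_sub_mono_ne_zero [NeZero r] (hr : 2 ≤ r) {m : ℕ} (hm : 0 < m) (j : Fin r) :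
    1 - mono K (simpleRoot m j) ≠ 0 := by
  rw [sub_ne_zero, ← mono_zero]
  intro h
  have h1 : (0 : Fin r → ℤ) = (m : ℤ) • gradRoot j := mono_injective h
  have h2 := congrArg (· ⬝ᵥ gradRoot j) h1
  simp only [zero_dotProduct, smul_dotProduct, gradRoot_dotProduct_self hr, smul_eq_mul] at h2
  omega

end Lin

/-! ## The operators of the basic representation -/

theorem map_geomQuot {A B F : Type*} [AddCommGroup A] [AddCommGroup B] [FunLike F A B]
    [AddMonoidHomClass F A B] (f : F) (y : ℤ → A) (u : ℤ) :
    f (geomQuot y u) = geomQuot (fun i => f (y i)) u := by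
  simp [geomQuot, map_sum]

section Embed

variable {K : Type} [Field K] [Algebra BaseField K] {r : ℕ}

/-- The inclusion of `𝔽[x^{±m}]` into `K[x^{±1}]`. -/
def embed (K : Type) [Field K] [Algebra BaseField K] (r m : ℕ) :
    LaurentM r m →ₐ[BaseField] Laurent K r :=
  AddMonoidAlgebra.lift BaseField (Laurent K r) (mLattice r m)
    { toFun := fun v => mono K ((v.toAdd : Fin r → ℤ), 0)
      map_one' := mono_zero
      map_mul' := fun v w => by simp [mono_mul] }

/-- The action of `𝔽[x^{±m}]` by multiplication. -/
def opX (K : Type) [Field K] [Algebra BaseField K] (r m : ℕ) :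
    LaurentM r m →ₐ[BaseField] Module.End K (Laurent K r) :=
  ((Algebra.lmul K (Laurent K r)).restrictScalars BaseField).comp (embed K r m)

theorem embed_monoM {m : ℕ} (w : Aff r) (hw : w.1 ∈ mLattice r m) :
    embed K r m (monoM w hw) = mono K w := by
  simp [embed, monoM, mono, AddMonoidAlgebra.lift_single, Algebra.smul_def,
    AddMonoidAlgebra.single_mul_single]

theorem opX_apply {m : ℕ} (f : LaurentM r m) (g : Laurent K r) :
    opX K r m f g = embed K r m f * g := rfl

/-- Powers of q are scalars. Formulas given on x^λ therefore extend to q^c x^λ, which is needed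
because s_0 and ω produce powers of q. -/
theorem mono_snd_add (v x : Aff r) :
    mono K (v + x) = algebraMap BaseField K (qVar ^ v.2) • mono K ((v.1, 0) + x) := by
  obtain ⟨v, c⟩ := v
  rw [← mono_mul, ← mono_mul, mono_eq_smul v c, smul_mul_assoc]

end Embed

section Operators

variable {K : Type} [Field K] [Algebra BaseField K] {r : ℕ} [NeZero r]

/-- The operator `T_j`, for parameters `p_j(λ) = P((λ, α_j))`. -/
def opT (m : ℕ) (P : ℤ → K) (j : Fin r) : Module.End K (Laurent K r) :=
  lin fun v => (kVar - kVar⁻¹) • metaDiff K m j v +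
    P (v ⬝ᵥ gradRoot j) • mono K (simpleRefl m j (v, 0))

/-- The operator `ω`. -/
def opOm (K : Type) [Field K] [Algebra BaseField K] (r m : ℕ) [NeZero r] :
    Module.End K (Laurent K r) :=
  lin fun v => mono K (omegaAct m (v, 0))

/-- The operator `ω⁻¹`. -/
def opOmInv (K : Type) [Field K] [Algebra BaseField K] (r m : ℕ) [NeZero r] :
    Module.End K (Laurent K r) :=
  lin fun v => mono K (omegaInvAct m (v, 0))

theorem simpleRefl_eq_add (hr : 2 ≤ r) (m : ℕ) (j : Fin r) (w : Aff r) :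
    simpleRefl m j w = (0, w.2) + simpleRefl m j (w.1, 0) := by
  rw [simpleRefl_eq_sub hr, simpleRefl_eq_sub hr, ← add_sub_assoc]
  congr 1
  ext1 <;> simp

theorem opT_mono (hr : 2 ≤ r) (m : ℕ) (P : ℤ → K) (j : Fin r) (w : Aff r) :
    opT m P j (mono K w) =
      (kVar - kVar⁻¹) • geomQuot (fun i => mono K (w + i • simpleRoot m j))
        (tRem m (w.1 ⬝ᵥ gradRoot j) / (m : ℤ)) +
      P (w.1 ⬝ᵥ gradRoot j) • mono K (simpleRefl m j w) := by
  obtain ⟨v, c⟩ := w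
  rw [mono_eq_smul, map_smul, opT, lin_mono]
  simp only [mono_snd_add (v, c), metaDiff]
  rw [simpleRefl_eq_add hr m j (v, c), mono_snd_add (0, c)]
  have h := map_geomQuot (LinearMap.lsmul K (Laurent K r) (algebraMap BaseField K (qVar ^ c)))
    (fun i => mono K ((v, 0) + i • simpleRoot m j)) (tRem m (v ⬝ᵥ gradRoot j) / (m : ℤ))
  simp only [LinearMap.lsmul_apply] at h
  rw [← h, smul_add, smul_comm (algebraMap BaseField K (qVar ^ c)) (kVar - kVar⁻¹),
    smul_comm (algebraMap BaseField K (qVar ^ c)) (P _)]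
  congr 4
  simp

theorem opOm_mono (m : ℕ) (w : Aff r) : opOm K r m (mono K w) = mono K (omegaAct m w) := by
  obtain ⟨v, c⟩ := w
  rw [mono_eq_smul, map_smul, opOm, lin_mono]
  have h : omegaAct m (v, c) = (0, c) + omegaAct m (v, 0) := by
    ext1
    · funext i; simp [omegaAct_fst]
    · simp only [omegaAct_snd, Prod.snd_add]; ring
  rw [h, mono_snd_add (0, c), Prod.mk_zero_zero, zero_add]

theorem opOmInv_mono (m : ℕ) (w : Aff r) :
    opOmInv K r m (mono K w) = mono K (omegaInvAct m w) := by
  obtain ⟨v, c⟩ := w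
  rw [mono_eq_smul, map_smul, opOmInv, lin_mono]
  have h : omegaInvAct m (v, c) = (0, c) + omegaInvAct m (v, 0) := by
    ext1
    · funext i; simp [omegaInvAct]
    · simp [omegaInvAct]
  rw [h, mono_snd_add (0, c), Prod.mk_zero_zero, zero_add]

theorem opOm_mul_opOmInv (m : ℕ) : opOm K r m * opOmInv K r m = 1 :=
  hom_ext_mono fun v => by
    simp [Module.End.mul_apply, opOmInv_mono, opOm_mono, omegaAct_omegaInvAct]

theorem opOmInv_mul_opOm (m : ℕ) : opOmInv K r m * opOm K r m = 1 :=
  hom_ext_mono fun v => by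
    simp [Module.End.mul_apply, opOmInv_mono, opOm_mono, omegaInvAct_omegaAct]

/-- ω takes the pairing with α_j, the root b_j and the reflection s_j to their analogues for j + 1,
and the parameter sees only the pairing. -/
theorem opOm_mul_opT (hr : 2 ≤ r) (m : ℕ) (P : ℤ → K) (j : Fin r) :
    opOm K r m * opT m P j = opT m P (j + 1) * opOm K r m := by
  refine hom_ext_mono fun v => ?_
  rw [Module.End.mul_apply, Module.End.mul_apply, opOm_mono, opT_mono hr, opT_mono hr,
    omegaAct_dotProduct, map_add, LinearMap.map_smul (opOm K r m),
    LinearMap.map_smul_of_tower (opOm K r m), opOm_mono,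
    omegaAct_simpleRefl hr, map_geomQuot]
  simp only [opOm_mono, omegaAct_add, ← omegaAct_simpleRoot]
  congr 3
  funext i
  congr 2
  exact map_zsmul (omegaHom r m) _ _

theorem opOm_mul_opX (m : ℕ) (w : Aff r) (hw : w.1 ∈ mLattice r m) :
    opOm K r m * opX K r m (monoM w hw) =
      opX K r m (monoM (omegaAct m w) (omegaAct_mem m hw)) * opOm K r m := by
  refine hom_ext_mono fun v => ?_
  simp only [Module.End.mul_apply, opX_apply, embed_monoM, opOm_mono, mono_mul, omegaAct_add]

/-! ### Cross relations between T_j and multiplication operators. -/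

theorem tRem_add_mul (m : ℕ) (s u : ℤ) : tRem m (s + m * u) = tRem m s + m * u := by
  simp only [tRem, Int.add_mul_emod_self_left]; ring

/-- The cross relation between `T_j` and multiplication by `x^μ` with `(μ, α_j)` divisible by `m`:
`D` is the divided difference `(x^μ - x^{s_j μ}) / (1 - x^{b_j})`. -/
theorem opT_mono_mul (hr : 2 ≤ r) {m : ℕ} (hm : 0 < m) (P : ℤ → K)
    (hP : ∀ s u : ℤ, P (s + m * u) = P s) (j : Fin r) (w : Aff r)
    (hw : (m : ℤ) ∣ w.1 ⬝ᵥ gradRoot j) (D : Laurent K r)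
    (hD : (1 - mono K (simpleRoot m j)) * D = mono K w - mono K (simpleRefl m j w))
    (f : Laurent K r) :
    opT m P j (mono K w * f) =
      mono K (simpleRefl m j w) * opT m P j f + (kVar - kVar⁻¹) • (D * f) := by
  have key : opT m P j ∘ₗ Algebra.lmul K (Laurent K r) (mono K w) =
      Algebra.lmul K (Laurent K r) (mono K (simpleRefl m j w)) ∘ₗ opT m P j +
        (kVar - kVar⁻¹) • Algebra.lmul K (Laurent K r) D := by
    refine hom_ext_mono fun v => ?_
    simp only [LinearMap.comp_apply, LinearMap.add_apply, LinearMap.smul_apply,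
      Algebra.coe_lmul_eq_mul, LinearMap.mul_apply_apply, mono_mul]
    have hm' : (m : ℤ) ≠ 0 := by exact_mod_cast hm.ne'
    obtain ⟨u, hu⟩ := hw
    have hB (z : Aff r) := geomQuot_spec (mono K (simpleRoot m j))
      (fun i => mono K (z + i • simpleRoot m j))
      (fun i => by rw [mono_mul]; congr 1; rw [add_smul, one_smul]; abel)
      (tRem m (z.1 ⬝ᵥ gradRoot j) / (m : ℤ))
    have h1 := hB (w + (v, 0))
    have h2 := hB (v, 0)
    have hdot : (w + ((v, 0) : Aff r)).1 ⬝ᵥ gradRoot j = v ⬝ᵥ gradRoot j + m * u := by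
      rw [Prod.fst_add, add_dotProduct, hu, add_comm]
    -- Since s_j w = w - u b_j, the far end of the string through w + v is s_j w plus the far end of
    -- the string through v.
    have hw' : w + ((v, 0) : Aff r) + -(tRem m (v ⬝ᵥ gradRoot j) / m + u) • simpleRoot m j =
        simpleRefl m j w + ((v, 0) + -(tRem m (v ⬝ᵥ gradRoot j) / m) • simpleRoot m j) := by
      rw [simpleRefl_eq_sub hr, hu, simpleRoot_eq_smul]
      module
    rw [opT_mono hr, opT_mono hr, hdot, tRem_add_mul, Int.add_mul_ediv_left _ _ hm', hP,
      simpleRefl_add hr]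
    rw [hdot, tRem_add_mul, Int.add_mul_ediv_left _ _ hm', hw', zero_smul, add_zero,
      ← mono_mul K w, ← mono_mul K (simpleRefl m j w)] at h1
    rw [zero_smul, add_zero] at h2
    rw [← mono_mul K (simpleRefl m j w)]
    -- After cancellation of the reflection terms, which agree by periodicity of `P`, only three
    -- telescoping identities for divided differences are left to combine.
    apply mul_left_cancel₀ (one_sub_mono_ne_zero (K := K) hr hm j)
    generalize geomQuot (A := Laurent K r) _ _ = G1 at h1 ⊢
    generalize geomQuot (A := Laurent K r) _ _ = G2 at h2 ⊢
    simp only [Algebra.smul_def]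
    linear_combination (algebraMap BaseField (Laurent K r) (kVar - kVar⁻¹)) * (h1 -
      mono K (simpleRefl m j w) * h2 - mono K (v, 0) * hD)
  exact LinearMap.congr_fun key f

theorem opT_mul_opX (hr : 2 ≤ r) {m : ℕ} (hm : 0 < m) (P : ℤ → K)
    (hP : ∀ s u : ℤ, P (s + m * u) = P s) (j : Fin r) (v : mLattice r m) :
    opT m P j * opX K r m (monoM ((v : Fin r → ℤ), 0) v.2) -
      opX K r m (monoM (simpleRefl m j ((v : Fin r → ℤ), 0)) (simpleRefl_mem m j v.2)) *
        opT m P j =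
      (kVar - kVar⁻¹) • opX K r m (divDiff m j v) := by
  refine LinearMap.ext fun f => ?_
  have hD := congrArg (embed K r m) (divDiff_spec m j v)
  simp only [map_mul, map_sub, map_one, embed_monoM] at hD
  have hv : (m : ℤ) ∣ (v : Fin r → ℤ) ⬝ᵥ gradRoot j := by
    rw [dotProduct_gradRoot]
    exact dvd_sub (v.2 _) (v.2 _)
  have := opT_mono_mul hr hm P hP j ((v : Fin r → ℤ), 0) hv _ hD f
  simp only [LinearMap.sub_apply, Module.End.mul_apply, opX_apply, embed_monoM,
    LinearMap.smul_apply, this]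
  abel

end Operators

/-! ## Commuting the defects of the Hecke relations past multiplication operators -/

section Abstract

variable {A : Type*} [Ring A]

/-- Here T T' X₁ = T' T X₁ = T' X₂ T' = X₁ T T'. Only commutation of T and T' is assumed, since T T'
= 1 is what this serves to prove. -/
theorem hecke_defect_mul_left {T T' X₁ X₂ : A} (hTT' : T * T' = T' * T) (h1 : T * X₁ = X₂ * T')
    (h2 : T' * X₂ = X₁ * T) : (T * T' - 1) * X₁ = X₁ * (T * T' - 1) := by
  rw [sub_mul, mul_sub, hTT', mul_assoc, h1, ← mul_assoc, h2, mul_assoc, hTT', one_mul, mul_one]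

theorem hecke_defect_mul_right {T T' X₁ X₂ : A} (hTT' : T * T' = T' * T)
    (h1 : T * X₁ = X₂ * T') (h2 : T' * X₂ = X₁ * T) :
    (T * T' - 1) * X₂ = X₂ * (T * T' - 1) := by
  rw [sub_mul, mul_sub, mul_assoc, h2, ← mul_assoc, h1, mul_assoc, hTT', one_mul, mul_one]

/-- The defect of the braid relation, for invertible elements satisfying the quadratic Hecke
relation, does not change when the outer factors are replaced by inverses. -/
theorem braid_defect_eq {F : Type*} [CommRing F] [Algebra F A] (c : F) {S T S' T' : A}
    (hS : S * S' = 1) (hT' : T' * T = 1) (eS : S' = S - algebraMap F A c)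
    (eT : T' = T - algebraMap F A c) :
    S * T * S - T * S * T = S * T' * S' - T' * S' * T := by
  have hc (x : A) : algebraMap F A c * x = x * algebraMap F A c := Algebra.commutes c x
  -- Inverting the middle factor costs c in both terms, and inverting an outer factor costs c S T in
  -- both, so the corrections cancel.
  have h1 : S * T' * S' = S * T * S' - algebraMap F A c := by
    rw [eT, mul_sub, sub_mul, mul_assoc S (algebraMap F A c), hc S', ← mul_assoc, hS, one_mul]
  have h2 : T' * S' * T = T' * S * T - algebraMap F A c := by
    rw [eS, mul_sub, sub_mul, mul_assoc T' (algebraMap F A c), hc T, ← mul_assoc T' T, hT', one_mul]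
  rw [h1, h2, eS, eT]
  simp only [mul_sub, sub_mul, mul_assoc, hc]
  abel

/-- X₁, X₂, X₃ stand for x_{j-1}^m, x_j^m, x_{j+1}^m, with S = T_j and T = T_{j+1}. Pushing X₁ to
the left turns it into X₃ and inverts the two factors that move it; by `braid_defect_eq` the defect
is unchanged. -/
theorem braid_defect_mul_fst {F : Type*} [CommRing F] [Algebra F A] (c : F)
    {S T S' T' X₁ X₂ X₃ : A} (hS : S * S' = 1) (hT' : T' * T = 1)
    (eS : S' = S - algebraMap F A c) (eT : T' = T - algebraMap F A c)
    (h1 : S * X₁ = X₂ * S') (h2 : T * X₂ = X₃ * T') (h3 : S * X₃ = X₃ * S)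
    (h4 : T * X₁ = X₁ * T) :
    (S * T * S - T * S * T) * X₁ = X₃ * (S * T * S - T * S * T) := by
  have e1 : S * T * S * X₁ = X₃ * (S * T' * S') := by
    rw [mul_assoc, h1, mul_assoc, ← mul_assoc T, h2, mul_assoc, ← mul_assoc S, h3]
    simp only [mul_assoc]
  have e2 : T * S * T * X₁ = X₃ * (T' * S' * T) := by
    rw [mul_assoc, h4, mul_assoc, ← mul_assoc S, h1, mul_assoc, ← mul_assoc T, h2]
    simp only [mul_assoc]
  rw [sub_mul, e1, e2, ← mul_sub, ← braid_defect_eq c hS hT' eS eT]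

/-- The mirror image: the defect is first written with inverses, and moving X₃ to the left removes
them. -/
theorem braid_defect_mul_trd {F : Type*} [CommRing F] [Algebra F A] (c : F)
    {S T S' T' X₁ X₂ X₃ : A} (hS : S' * S = 1) (hT' : T * T' = 1)
    (eS : S' = S - algebraMap F A c) (eT : T' = T - algebraMap F A c)
    (h1 : S' * X₂ = X₁ * S) (h2 : T' * X₃ = X₂ * T) (h3 : S * X₃ = X₃ * S)
    (h4 : T * X₁ = X₁ * T) :
    (S * T * S - T * S * T) * X₃ = X₁ * (S * T * S - T * S * T) := by
  have e0 := braid_defect_eq c hT' hS eT eS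
  have e1 : S' * T' * S * X₃ = X₁ * (S * T * S) := by
    rw [mul_assoc, h3, mul_assoc, ← mul_assoc T', h2, mul_assoc, ← mul_assoc S', h1]
    simp only [mul_assoc]
  have e2 : T * S' * T' * X₃ = X₁ * (T * S * T) := by
    rw [mul_assoc, h2, mul_assoc, ← mul_assoc S', h1, mul_assoc, ← mul_assoc T, h4]
    simp only [mul_assoc]
  calc (S * T * S - T * S * T) * X₃ = -((T * S' * T' - S' * T' * S) * X₃) := by
        rw [← e0, ← neg_mul, neg_sub]
    _ = X₁ * (S * T * S - T * S * T) := by rw [sub_mul, e1, e2, ← mul_sub, ← mul_neg, neg_sub]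

/-- Expand with S² = c S + 1. This lets the defect pass a generator, which is how the middle
operator X₂ is reached. -/
theorem braid_defect_mul_gen {F : Type*} [CommRing F] [Algebra F A] (c : F)
    {S T S' T' : A} (hS : S * S' = 1) (hT : T' * T = 1)
    (eS : S' = S - algebraMap F A c) (eT : T' = T - algebraMap F A c) :
    (S * T * S - T * S * T) * S = -(T' * (S * T * S - T * S * T)) := by
  have hc (x : A) : algebraMap F A c * x = x * algebraMap F A c := Algebra.commutes c x
  have h1 : S * S = algebraMap F A c * S + 1 := by
    rw [← hS, eS, mul_sub, hc]; abel
  have h2 : T' * (T * S * T) = S * T := by rw [← mul_assoc, ← mul_assoc, hT, one_mul]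
  have h3 : S * T * S * S = S * T * S * algebraMap F A c + S * T := by
    rw [mul_assoc, h1, mul_add, mul_one, hc, ← mul_assoc]
  rw [sub_mul, mul_sub, h2, h3, eT, sub_mul, hc]
  simp only [mul_assoc]
  abel

/-- Write X₂ = S X₁ S. Passing the defect across turns each S into -T' and X₁ into X₃, and T' X₃ T'
= X₂. -/
theorem braid_defect_mul_snd {F : Type*} [CommRing F] [Algebra F A] (c : F)
    {S T S' T' X₁ X₂ X₃ : A} (hS : S * S' = 1) (hS' : S' * S = 1) (hT' : T' * T = 1)
    (hT : T * T' = 1)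
    (eS : S' = S - algebraMap F A c) (eT : T' = T - algebraMap F A c)
    (h1 : S * X₁ = X₂ * S') (h2 : T * X₂ = X₃ * T') (h2' : T' * X₃ = X₂ * T)
    (h3 : S * X₃ = X₃ * S) (h4 : T * X₁ = X₁ * T) :
    (S * T * S - T * S * T) * X₂ = X₂ * (S * T * S - T * S * T) := by
  have e1 := braid_defect_mul_fst c hS hT' eS eT h1 h2 h3 h4
  have e2 := braid_defect_mul_gen c hS hT' eS eT
  have e3 : X₂ = S * X₁ * S := by rw [h1, mul_assoc, hS', mul_one]
  generalize S * T * S - T * S * T = Z at e1 e2 ⊢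
  calc Z * X₂ = Z * S * X₁ * S := by rw [e3]; simp only [mul_assoc]
    _ = -(T' * (Z * X₁) * S) := by rw [e2]; simp only [neg_mul, mul_assoc]
    _ = -(T' * X₃ * (Z * S)) := by rw [e1]; simp only [mul_assoc]
    _ = T' * X₃ * T' * Z := by rw [e2]; simp only [mul_neg, neg_neg, mul_assoc]
    _ = X₂ * Z := by rw [h2', mul_assoc X₂, hT, mul_one]

/-- In use, U and S differ by a scalar, so they have the same commutator with T. -/
theorem mul_mul_comm_of {S X Y U T : A} (h1 : S * X = Y * U) (h2 : T * X = X * T)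
    (h3 : T * Y = Y * T) (h4 : U * T - T * U = S * T - T * S) :
    (S * T - T * S) * X = Y * (S * T - T * S) := by
  rw [sub_mul, mul_assoc, h2, ← mul_assoc, h1, mul_assoc T, h1, ← mul_assoc, h3, mul_assoc,
    mul_assoc, ← mul_sub, h4]

end Abstract

/-! ## The relations on the span of an orbit in the fundamental box -/

section Box

variable {K V : Type*} [Field K] [AddCommGroup V] [Module K V] {m : ℕ} {k : K} {P : ℤ → K}

/-- For x ≠ y, T acts on the pair E x y, E y x with one diagonal entry k - k⁻¹, the other 0, and
off-diagonal entries of product P(s) P(-s) = 1. For x = y it acts by k, a root of the quadratic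
relation. -/
theorem hecke_box (hk : k ≠ 0) (P0 : P 0 = k) (PP : ∀ s : ℤ, ¬ (m : ℤ) ∣ s → P s * P (-s) = 1)
    {T : Module.End K V} {E : ℤ → ℤ → V}
    (hT : ∀ x y : ℤ, 0 ≤ x → x < m → 0 ≤ y → y < m →
      T (E x y) = P (x - y) • E y x + if x < y then (k - k⁻¹) • E x y else 0)
    {x y : ℤ} (hx : 0 ≤ x) (hx' : x < m) (hy : 0 ≤ y) (hy' : y < m) :
    T (T (E x y)) = (k - k⁻¹) • T (E x y) + E x y := by
  have nd (s : ℤ) (h0 : s ≠ 0) (h1 : s < m) (h2 : -s < m) : P s * P (-s) = 1 :=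
    PP s fun h => h0 (Int.eq_zero_of_abs_lt_dvd h (abs_lt.2 ⟨by omega, h1⟩))
  rcases lt_trichotomy x y with h | rfl | h
  · have e := nd (x - y) (by omega) (by omega) (by omega)
    rw [neg_sub] at e
    simp only [hT, hx, hx', hy, hy', h, h.not_gt, if_true, if_false, map_add, map_smul, add_zero]
    match_scalars
    · linear_combination e
    · ring
  · simp only [hT, hx, hx', sub_self, P0, lt_irrefl, if_false, map_smul, add_zero]
    match_scalars
    field_simp
    ring
  · have e := nd (x - y) (by omega) (by omega) (by omega)
    rw [neg_sub] at e
    simp only [hT, hx, hx', hy, hy', h, h.not_gt, if_true, if_false, map_smul, add_zero]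
    match_scalars
    · linear_combination e
    · ring

theorem braid_box (hk : k ≠ 0) (P0 : P 0 = k) (PP : ∀ s : ℤ, ¬ (m : ℤ) ∣ s → P s * P (-s) = 1)
    {S T : Module.End K V} {E : ℤ → ℤ → ℤ → V}
    (hS : ∀ x y z : ℤ, 0 ≤ x → x < m → 0 ≤ y → y < m → 0 ≤ z → z < m →
      S (E x y z) = P (x - y) • E y x z + if x < y then (k - k⁻¹) • E x y z else 0)
    (hT : ∀ x y z : ℤ, 0 ≤ x → x < m → 0 ≤ y → y < m → 0 ≤ z → z < m →
      T (E x y z) = P (y - z) • E x z y + if y < z then (k - k⁻¹) • E x y z else 0)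
    {x y z : ℤ} (hx : 0 ≤ x) (hx' : x < m) (hy : 0 ≤ y) (hy' : y < m) (hz : 0 ≤ z)
    (hz' : z < m) :
    S (T (S (E x y z))) = T (S (T (E x y z))) := by
  have nd (a b : ℤ) (h0 : a ≠ b) (ha : 0 ≤ a) (ha' : a < m) (hb : 0 ≤ b) (hb' : b < m) :
      P (a - b) * P (b - a) = 1 := by
    rw [← neg_sub a b]
    exact PP _ fun h => h0 (by
      have := Int.eq_zero_of_abs_lt_dvd h (abs_lt.2 ⟨by omega, by omega⟩)
      omega)
  have hkk : k * k⁻¹ = 1 := mul_inv_cancel₀ hk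
  have exy := fun h : x ≠ y => nd x y h hx hx' hy hy'
  have exz := fun h : x ≠ z => nd x z h hx hx' hz hz'
  have eyz := fun h : y ≠ z => nd y z h hy hy' hz hz'
  -- Which terms appear depends only on the relative order of x, y, z. Of the 27 sign patterns, 13
  -- are weak orderings; the others are contradictory.
  rcases lt_trichotomy x y with h1 | h1 | h1 <;> rcases lt_trichotomy y z with h2 | h2 | h2 <;>
    rcases lt_trichotomy x z with h3 | h3 | h3 <;> try (exfalso; omega)
  all_goals
    try subst h1
    try subst h2
    try subst h3
    simp only [*, sub_self, lt_irrefl, not_lt_of_gt, if_true, if_false, map_add, map_smul, add_zero]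
    try match_scalars
  all_goals first | ring1 | grind

end Box

/-! ### Reduction to exponents in [0, m), and the finite T_j against x_i^m. -/

section Concrete

variable {K : Type} [Field K] [Algebra BaseField K] {r : ℕ}

/-- Multiplication by `x_i^m`. -/
def opXm (K : Type) [Field K] [Algebra BaseField K] {r : ℕ} (m : ℕ) (i : Fin r) :
    Module.End K (Laurent K r) :=
  Algebra.lmul K (Laurent K r) (mono K ((m : ℤ) • eps i, 0))

theorem opXm_apply (m : ℕ) (i : Fin r) (f : Laurent K r) :
    opXm K m i f = mono K ((m : ℤ) • eps i, 0) * f := rfl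

theorem opXm_mono (m : ℕ) (i : Fin r) (v : Fin r → ℤ) :
    opXm K m i (mono K (v, 0)) = mono K ((m : ℤ) • eps i + v, 0) := by
  rw [opXm_apply, mono_mul, Prod.mk_add_mk, add_zero]

theorem opXm_injective (m : ℕ) (i : Fin r) : Function.Injective (opXm K m i) := by
  intro f g h
  have := congrArg (mono K (-((m : ℤ) • eps i), 0) * ·) h
  simp only [opXm_apply, ← mul_assoc, mono_mul] at this
  simpa [mono_zero, Prod.mk_zero_zero] using this

/-- An operator which intertwines the multiplications by `x_i^m` vanishes as soon as it kills the
monomials with exponents in `[0, m)`. -/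
theorem eq_zero_of_intertwining {m : ℕ} (hm : 0 < m) {Z : Module.End K (Laurent K r)}
    (hX : ∀ i, ∃ i', Z * opXm K m i = opXm K m i' * Z)
    (h0 : ∀ v : Fin r → ℤ, (∀ i, 0 ≤ v i) → (∀ i, v i < m) → Z (mono K (v, 0)) = 0) : Z = 0 := by
  -- The shifts of the exponent that neither create nor destroy vanishing under Z. Stating this as
  -- an equivalence makes it closed under negation; multiplication by x_{i'}^m being injective puts
  -- m ε_i in it.
  let G : AddSubgroup (Fin r → ℤ) :=
    { carrier := {u | ∀ v, Z (mono K (v, 0)) = 0 ↔ Z (mono K (u + v, 0)) = 0}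
      zero_mem' := fun v => by rw [zero_add]
      add_mem' := fun {a b} ha hb v => by rw [hb v, ha (b + v), add_assoc]
      neg_mem' := fun {a} ha v => by rw [ha (-a + v), add_neg_cancel_left] }
  have hG (i : Fin r) : (m : ℤ) • eps i ∈ G := fun v => by
    obtain ⟨i', hi'⟩ := hX i
    have := LinearMap.congr_fun hi' (mono K (v, 0))
    rw [Module.End.mul_apply, Module.End.mul_apply, opXm_mono] at this
    rw [this, map_eq_zero_iff _ (opXm_injective m i')]
  refine hom_ext_mono fun v => ?_
  rw [LinearMap.zero_apply]
  -- Division with remainder in every coordinate brings v into the box modulo m ℤ^r.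
  have hv : v = (∑ i, (v i / m) • (m : ℤ) • eps i) + fun i => v i % m := by
    funext i
    simp only [Pi.add_apply, Finset.sum_apply, Pi.smul_apply, eps, Pi.single_apply, smul_eq_mul,
      mul_ite, mul_one, mul_zero, Finset.sum_ite_eq, Finset.mem_univ, if_true]
    rw [mul_comm, Int.mul_ediv_add_emod]
  rw [hv]
  have hm' : (0 : ℤ) < m := by exact_mod_cast hm
  have hsum : (∑ i, (v i / m) • (m : ℤ) • eps i) ∈ G := sum_mem fun i _ => zsmul_mem (hG i) _
  exact (hsum _).1
      (h0 _ (fun i => Int.emod_nonneg _ hm'.ne') (fun i => Int.emod_lt_of_pos _ hm'))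

variable [NeZero r]

/-- The difference of the two exponents lies strictly between -m and m, so t_m is 0 or -m, and the
divided difference is empty or the single term x^λ. -/
theorem opT_box (hr : 2 ≤ r) {m : ℕ} (hm : 0 < m) (P : ℤ → K) {j : Fin r} (hj : j ≠ 0)
    (v : Fin r → ℤ) (h0 : ∀ i, 0 ≤ v i) (h1 : ∀ i, v i < m) :
    opT m P j (mono K (v, 0)) = P (v (j - 1) - v j) • mono K (v ∘ Equiv.swap (j - 1) j, 0) +
      if v (j - 1) < v j then
        (algebraMap BaseField K kVar - (algebraMap BaseField K kVar)⁻¹) • mono K (v, 0) else 0 := by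
  have ha := h0 (j - 1); have ha' := h1 (j - 1); have hb := h0 j; have hb' := h1 j
  have hm' : (m : ℤ) ≠ 0 := by exact_mod_cast hm.ne'
  rw [opT_mono hr, simpleRefl_of_ne m hj, dotProduct_gradRoot, add_comm]
  congr 1
  split_ifs with h
  · have : tRem m (v (j - 1) - v j) / (m : ℤ) = -1 := by
      have e : (v (j - 1) - v j) % (m : ℤ) = v (j - 1) - v j + m := by
        rw [← Int.add_emod_right, Int.emod_eq_of_lt] <;> omega
      rw [tRem, e, sub_add_cancel_left, Int.neg_ediv_of_dvd dvd_rfl, Int.ediv_self hm']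
    rw [this]
    simp [geomQuot, ← algebraMap_smul K (kVar - kVar⁻¹)]
  · have : tRem m (v (j - 1) - v j) / (m : ℤ) = 0 := by
      rw [tRem, Int.emod_eq_of_lt (by omega) (by omega), sub_self, Int.zero_ediv]
    rw [this]
    simp [geomQuot]

theorem simpleRefl_smul_eps (m : ℕ) {j : Fin r} (hj : j ≠ 0) (i : Fin r) :
    simpleRefl m j ((m : ℤ) • eps i, 0) = ((m : ℤ) • eps (Equiv.swap (j - 1) j i), 0) := by
  rw [simpleRefl_of_ne m hj]
  ext1
  · funext l
    simp only [Function.comp_apply, Pi.smul_apply, eps, Pi.single_apply, Equiv.swap_apply_eq_iff]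
  · rfl

variable {m : ℕ} {P : ℤ → K} {j : Fin r}

/-- For μ = m ε_i the divided difference `D` is -x_j^m, x_j^m or 0, according as i is j - 1, j or
neither; each use supplies its value. -/
theorem opT_mul_opXm_of_divDiff (hr : 2 ≤ r) (hm : 0 < m) (hP : ∀ s u : ℤ, P (s + m * u) = P s)
    (hj : j ≠ 0) (i : Fin r) (D : Laurent K r)
    (hD : (1 - mono K (simpleRoot m j)) * D = mono K ((m : ℤ) • eps i, 0) -
      mono K ((m : ℤ) • eps (Equiv.swap (j - 1) j i), 0)) :
    opT m P j * opXm K m i = opXm K m (Equiv.swap (j - 1) j i) * opT m P j +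
      (kVar - kVar⁻¹) • Algebra.lmul K (Laurent K r) D := by
  refine LinearMap.ext fun f => ?_
  rw [← simpleRefl_smul_eps m hj] at hD
  have := opT_mono_mul hr hm P hP j ((m : ℤ) • eps i, 0) (by
    rw [smul_dotProduct, smul_eq_mul]; exact dvd_mul_right _ _) D hD f
  rwa [simpleRefl_smul_eps m hj] at this

theorem simpleRoot_add_eps (hj : j ≠ 0) (m : ℕ) :
    simpleRoot m j + ((m : ℤ) • eps j, 0) = ((m : ℤ) • eps (j - 1), 0) := by
  simp [simpleRoot, hj, gradRoot_eq_sub, smul_sub]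

/-- The correction term is absorbed into T_j - (k - k⁻¹), the prospective inverse of T_j. This is
the form that the abstract defect lemmas require. -/
theorem opT_mul_opXm_pred (hr : 2 ≤ r) (hm : 0 < m) (hP : ∀ s u : ℤ, P (s + m * u) = P s)
    (hj : j ≠ 0) :
    opT m P j * opXm K m (j - 1) =
      opXm K m j * (opT m P j - algebraMap BaseField _ (kVar - kVar⁻¹)) := by
  have h := opT_mul_opXm_of_divDiff (P := P) hr hm hP hj (j - 1) (-mono K ((m : ℤ) • eps j, 0)) (by
    rw [Equiv.swap_apply_left, ← simpleRoot_add_eps hj, ← mono_mul]; ring)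
  rw [Equiv.swap_apply_left] at h
  rw [h, mul_sub, ← Algebra.commutes, ← Algebra.smul_def, map_neg, smul_neg]
  exact (sub_eq_add_neg _ _).symm

theorem opT_mul_opXm_self (hr : 2 ≤ r) (hm : 0 < m) (hP : ∀ s u : ℤ, P (s + m * u) = P s)
    (hj : j ≠ 0) :
    (opT m P j - algebraMap BaseField _ (kVar - kVar⁻¹)) * opXm K m j =
      opXm K m (j - 1) * opT m P j := by
  have h := opT_mul_opXm_of_divDiff (P := P) hr hm hP hj j (mono K ((m : ℤ) • eps j, 0)) (by
    rw [Equiv.swap_apply_right, ← simpleRoot_add_eps hj, ← mono_mul]; ring)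
  rw [Equiv.swap_apply_right] at h
  rw [sub_mul, h, ← Algebra.smul_def, sub_eq_iff_eq_add]
  rfl

theorem opT_mul_opXm_of_ne (hr : 2 ≤ r) (hm : 0 < m) (hP : ∀ s u : ℤ, P (s + m * u) = P s)
    (hj : j ≠ 0) {i : Fin r} (h1 : i ≠ j - 1) (h2 : i ≠ j) :
    opT m P j * opXm K m i = opXm K m i * opT m P j := by
  have h := opT_mul_opXm_of_divDiff (P := P) hr hm hP hj i 0 (by
    rw [Equiv.swap_apply_of_ne_of_ne h1 h2, mul_zero, sub_self])
  rw [Equiv.swap_apply_of_ne_of_ne h1 h2] at h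
  rw [h, map_zero, smul_zero, add_zero]

end Concrete

/-! ### Exchanging selected coordinates of a vector. -/

section Swap

variable {ι α : Type*} [DecidableEq ι] {a b c d : ι}

theorem ite_comp_swap (hab : a ≠ b) (x y : α) (v : ι → α) :
    (fun i => if i = a then x else if i = b then y else v i) ∘ Equiv.swap a b =
      fun i => if i = a then y else if i = b then x else v i := by
  funext i
  simp only [Function.comp_apply, Equiv.swap_apply_def]
  grind

theorem ite_ite_comp_swap_left (hab : a ≠ b) (x y z : α) (v : ι → α) :
    (fun i => if i = a then x else if i = b then y else if i = c then z else v i) ∘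
        Equiv.swap a b =
      fun i => if i = a then y else if i = b then x else if i = c then z else v i := by
  funext i
  simp only [Function.comp_apply, Equiv.swap_apply_def]
  grind

theorem ite_ite_comp_swap_right (hab : a ≠ b) (hac : a ≠ c) (hbc : b ≠ c) (x y z : α)
    (v : ι → α) :
    (fun i => if i = a then x else if i = b then y else if i = c then z else v i) ∘
        Equiv.swap b c =
      fun i => if i = a then x else if i = b then z else if i = c then y else v i := by
  funext i
  simp only [Function.comp_apply, Equiv.swap_apply_def]
  grind

theorem comp_swap_comp_swap_comm (hac : a ≠ c) (had : a ≠ d) (hbc : b ≠ c) (hbd : b ≠ d)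
    (v : ι → α) :
    (v ∘ Equiv.swap a b) ∘ Equiv.swap c d = (v ∘ Equiv.swap c d) ∘ Equiv.swap a b := by
  funext i
  simp only [Function.comp_apply, Equiv.swap_apply_def]
  grind

end Swap

theorem neg_commutator_mul {A : Type*} [Ring A] {S T X Y : A}
    (h : (S * T - T * S) * X = Y * (S * T - T * S)) :
    (T * S - S * T) * X = Y * (T * S - S * T) := by
  rw [← neg_sub (S * T), neg_mul, h, mul_neg]

/-! ### Quadratic, braid and commutation relations for finite indices. -/

section Relations

variable {K : Type} [Field K] [Algebra BaseField K] {r : ℕ} [NeZero r] {m : ℕ} {P : ℤ → K}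

theorem kVar_ne_zero : kVar ≠ 0 := by
  unfold kVar
  rw [Ne, IsFractionRing.to_map_eq_zero_iff]
  exact MvPolynomial.X_ne_zero 1

/-- The conditions on the parameters `p_j(λ) = P((λ, α_j))`. -/
structure IsParam (m : ℕ) (P : ℤ → K) : Prop where
  periodic : ∀ s u : ℤ, P (s + m * u) = P s
  zero : P 0 = algebraMap BaseField K kVar
  mul_neg : ∀ s : ℤ, ¬ (m : ℤ) ∣ s → P s * P (-s) = 1

theorem algebraMap_kVar_ne_zero : algebraMap BaseField K kVar ≠ 0 := by
  rw [Ne, map_eq_zero]; exact kVar_ne_zero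

/-- The operator `T_j - (k - k⁻¹)`, which is inverse to `T_j`. -/
def opT' (m : ℕ) (P : ℤ → K) (j : Fin r) : Module.End K (Laurent K r) :=
  opT m P j - algebraMap BaseField _ (kVar - kVar⁻¹)

theorem opT_comm_opT' (j : Fin r) : opT m P j * opT' m P j = opT' m P j * opT m P j := by
  rw [opT', mul_sub, sub_mul, Algebra.commutes]

theorem opT_mul_opT'_of_ne (hr : 2 ≤ r) (hm : 0 < m) (hP : IsParam m P) {j : Fin r} (hj : j ≠ 0) :
    opT m P j * opT' m P j = 1 := by
  have h1 := opT_mul_opXm_pred (P := P) hr hm hP.periodic hj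
  have h2 := opT_mul_opXm_self (P := P) hr hm hP.periodic hj
  have hne := sub_one_ne hr j
  rw [← sub_eq_zero]
  refine eq_zero_of_intertwining hm (fun i => ?_) fun v hv0 hv1 => ?_
  · by_cases hi : i = j - 1
    · subst hi
      exact ⟨_, hecke_defect_mul_left (opT_comm_opT' j) h1 h2⟩
    by_cases hi' : i = j
    · subst hi'
      exact ⟨_, hecke_defect_mul_right (opT_comm_opT' i) h1 h2⟩
    · have h3 := opT_mul_opXm_of_ne (P := P) hr hm hP.periodic hj hi hi'
      have h4 : Commute (opT m P j) (opXm K m i) := h3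
      exact ⟨i, (h4.mul_left (h4.sub_left (Algebra.commutes _ _))).sub_left (Commute.one_left _)⟩
  -- T_j moves only the exponents at j - 1 and j; the others stay frozen at those of v.
  · let E : ℤ → ℤ → Laurent K r := fun x y =>
      mono K (fun i => if i = j - 1 then x else if i = j then y else v i, 0)
    have hE : E (v (j - 1)) (v j) = mono K (v, 0) := by
      simp only [E]; congr 2; funext i; split_ifs <;> simp [*]
    have := hecke_box (m := m) (E := E) (T := opT m P j) algebraMap_kVar_ne_zero hP.zero hP.mul_neg
      (fun x y hx hx' hy hy' => by
        simp only [E]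
        rw [opT_box hr hm P hj _ (fun i => by split_ifs <;> simp [*])
          (fun i => by split_ifs <;> simp [*])]
        simp only [if_true, hne.symm, if_false]
        rw [ite_comp_swap hne]) (hv0 (j - 1)) (hv1 _) (hv0 j) (hv1 _)
    rw [hE] at this
    rw [LinearMap.sub_apply, opT_comm_opT', Module.End.mul_apply, opT', LinearMap.sub_apply, this,
      Module.algebraMap_end_apply, ← algebraMap_smul K (kVar - kVar⁻¹), Module.End.one_apply, map_sub,
      map_inv₀]
    abel

theorem opT_braid_of_ne (hr : 3 ≤ r) (hm : 0 < m) (hP : IsParam m P) {j : Fin r} (hj : j ≠ 0)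
    (hj' : j + 1 ≠ 0) :
    opT m P j * opT m P (j + 1) * opT m P j = opT m P (j + 1) * opT m P j * opT m P (j + 1) := by
  have hr2 : 2 ≤ r := by omega
  have hS := opT_mul_opT'_of_ne hr2 hm hP hj
  have hT := opT_mul_opT'_of_ne hr2 hm hP hj'
  have hS' := (opT_comm_opT' _).symm.trans hS
  have hT' := (opT_comm_opT' _).symm.trans hT
  have hper := hP.periodic
  have h1 := opT_mul_opXm_pred (P := P) hr2 hm hper hj
  have h1' := opT_mul_opXm_self (P := P) hr2 hm hper hj
  have h2 := opT_mul_opXm_pred (P := P) hr2 hm hper hj'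
  have h2' := opT_mul_opXm_self (P := P) hr2 hm hper hj'
  have n1 : j - 1 ≠ j := sub_one_ne hr2 j
  have n2 : j ≠ j + 1 := by simpa using sub_one_ne hr2 (j + 1)
  -- This is where r ≥ 3 is needed: the three coordinates involved must be distinct.
  have n3 : j - 1 ≠ j + 1 := by
    intro h
    rw [sub_eq_iff_eq_add, add_assoc, left_eq_add] at h
    have := congrArg Fin.val h
    rw [Fin.val_add, Fin.val_one', Fin.val_zero, Nat.mod_eq_of_lt (a := 1) (by omega),
      Nat.mod_eq_of_lt (by omega)] at this
    omega
  have e : j + 1 - 1 = j := add_sub_cancel_right j 1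
  rw [e] at h2 h2'
  have h3 := opT_mul_opXm_of_ne (P := P) hr2 hm hper hj n3.symm n2.symm
  have h4 := opT_mul_opXm_of_ne (P := P) hr2 hm hper hj' (i := j - 1) (by rwa [e]) n3
  rw [← sub_eq_zero]
  refine eq_zero_of_intertwining hm (fun i => ?_) fun v hv0 hv1 => ?_
  · by_cases hi1 : i = j - 1
    · subst hi1
      exact ⟨_, braid_defect_mul_fst _ hS hT' rfl rfl h1 h2 h3 h4⟩
    by_cases hi2 : i = j
    · subst hi2
      exact ⟨_, braid_defect_mul_snd _ hS hS' hT' hT rfl rfl h1 h2 h2' h3 h4⟩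
    by_cases hi3 : i = j + 1
    · subst hi3
      exact ⟨_, braid_defect_mul_trd _ hS' hT rfl rfl h1' h2' h3 h4⟩
    · have h5 := opT_mul_opXm_of_ne (P := P) hr2 hm hper hj hi1 hi2
      have h6 := opT_mul_opXm_of_ne (P := P) hr2 hm hper hj' (i := i) (by rwa [e]) hi3
      have c5 : Commute (opT m P j) (opXm K m i) := h5
      have c6 : Commute (opT m P (j + 1)) (opXm K m i) := h6
      exact ⟨i, ((c5.mul_left c6).mul_left c5).sub_left ((c6.mul_left c5).mul_left c6)⟩
  · let E : ℤ → ℤ → ℤ → Laurent K r := fun x y z =>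
      mono K (fun i => if i = j - 1 then x else if i = j then y else if i = j + 1 then z else v i, 0)
    have hE : E (v (j - 1)) (v j) (v (j + 1)) = mono K (v, 0) := by
      simp only [E]; congr 2; funext i; split_ifs <;> simp [*]
    have := braid_box (m := m) (E := E) (S := opT m P j) (T := opT m P (j + 1))
      algebraMap_kVar_ne_zero hP.zero hP.mul_neg
      (fun x y z hx hx' hy hy' hz hz' => by
        simp only [E]
        rw [opT_box hr2 hm P hj _ (fun i => by split_ifs <;> simp [*])
          (fun i => by split_ifs <;> simp [*])]
        simp only [if_true, n1.symm, if_false]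
        rw [ite_ite_comp_swap_left n1])
      (fun x y z hx hx' hy hy' hz hz' => by
        simp only [E]
        rw [opT_box hr2 hm P hj' _ (fun i => by split_ifs <;> simp [*])
          (fun i => by split_ifs <;> simp [*])]
        simp only [e, if_true, n1.symm, n2.symm, n3.symm, if_false]
        rw [ite_ite_comp_swap_right n1 n3 n2]) (hv0 (j - 1)) (hv1 _) (hv0 j) (hv1 _) (hv0 (j + 1)) (hv1 _)
    rw [hE] at this
    simp only [LinearMap.sub_apply, Module.End.mul_apply, this, sub_self]

theorem opT_comm_of_ne (hr : 2 ≤ r) (hm : 0 < m) (hP : IsParam m P) {i j : Fin r} (hi : i ≠ 0)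
    (hj : j ≠ 0) (hij : i ≠ j) (h1 : i ≠ j + 1) (h2 : j ≠ i + 1) :
    opT m P i * opT m P j = opT m P j * opT m P i := by
  have hper := hP.periodic
  have ni := sub_one_ne hr i
  have nj := sub_one_ne hr j
  have n1 : i - 1 ≠ j := fun h => h1 (sub_eq_iff_eq_add.1 h)
  have n2 : j - 1 ≠ i := fun h => h2 (sub_eq_iff_eq_add.1 h)
  have n3 : i - 1 ≠ j - 1 := fun h => hij (sub_left_inj.1 h)
  -- Covers the x_l^m moved by T_i. Those moved by T_j follow by exchanging the roles of i and j,
  -- which negates the commutator.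
  have aux {i j : Fin r} (hi : i ≠ 0) (hj : j ≠ 0) (n0 : i ≠ j) (n1 : i - 1 ≠ j) (n2 : j - 1 ≠ i)
      (n3 : i - 1 ≠ j - 1) (l : Fin r) (hl : l = i - 1 ∨ l = i) :
      ∃ l', (opT m P i * opT m P j - opT m P j * opT m P i) * opXm K m l =
        opXm K m l' * (opT m P i * opT m P j - opT m P j * opT m P i) := by
    have c1 := opT_mul_opXm_of_ne (P := P) hr hm hper hj n3 n1
    have c2 := opT_mul_opXm_of_ne (P := P) hr hm hper hj (i := i) n2.symm n0
    have d1 := opT_mul_opXm_pred (P := P) hr hm hper hi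
    have d2 := opT_mul_opXm_self (P := P) hr hm hper hi
    have hc : opT' m P i * opT m P j - opT m P j * opT' m P i =
        opT m P i * opT m P j - opT m P j * opT m P i := by
      rw [opT', sub_mul, mul_sub, Algebra.commutes]; abel
    rcases hl with rfl | rfl
    · exact ⟨i, mul_mul_comm_of d1 c1 c2 hc⟩
    · refine ⟨l - 1, ?_⟩
      rw [← hc]
      exact mul_mul_comm_of d2 c2 c1 hc.symm
  rw [← sub_eq_zero]
  refine eq_zero_of_intertwining hm (fun l => ?_) fun v hv0 hv1 => ?_
  · by_cases hl : l = i - 1 ∨ l = i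
    · exact aux hi hj hij n1 n2 n3 l hl
    by_cases hl' : l = j - 1 ∨ l = j
    · obtain ⟨l', h⟩ := aux hj hi hij.symm n2 n1 n3.symm l hl'
      exact ⟨l', neg_commutator_mul h⟩
    · push Not at hl hl'
      have c1 : Commute (opT m P i) (opXm K m l) := opT_mul_opXm_of_ne hr hm hper hi hl.1 hl.2
      have c2 : Commute (opT m P j) (opXm K m l) := opT_mul_opXm_of_ne hr hm hper hj hl'.1 hl'.2
      exact ⟨l, (c1.mul_left c2).sub_left (c2.mul_left c1)⟩
  · have b1 (l : Fin r) (s : Equiv.Perm (Fin r)) : 0 ≤ (v ∘ s) l := hv0 _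
    have b2 (l : Fin r) (s : Equiv.Perm (Fin r)) : (v ∘ s) l < m := hv1 _
    have hsw : (v ∘ Equiv.swap (i - 1) i) ∘ Equiv.swap (j - 1) j =
        (v ∘ Equiv.swap (j - 1) j) ∘ Equiv.swap (i - 1) i :=
      comp_swap_comp_swap_comm n3 n1 n2.symm hij v
    have e1 : Equiv.swap (i - 1) i (j - 1) = j - 1 := Equiv.swap_apply_of_ne_of_ne n3.symm n2
    have e2 : Equiv.swap (i - 1) i j = j := Equiv.swap_apply_of_ne_of_ne n1.symm hij.symm
    have e3 : Equiv.swap (j - 1) j (i - 1) = i - 1 := Equiv.swap_apply_of_ne_of_ne n3 n1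
    have e4 : Equiv.swap (j - 1) j i = i := Equiv.swap_apply_of_ne_of_ne n2.symm hij
    rw [LinearMap.sub_apply, Module.End.mul_apply, Module.End.mul_apply,
      opT_box hr hm P hi v hv0 hv1, opT_box hr hm P hj v hv0 hv1, map_add, map_add, map_smul,
      map_smul,
      opT_box hr hm P hi (v ∘ Equiv.swap (j - 1) j) (b1 · _) (b2 · _),
      opT_box hr hm P hj (v ∘ Equiv.swap (i - 1) i) (b1 · _) (b2 · _), hsw]
    simp only [Function.comp_apply, e1, e2, e3, e4]
    by_cases p1 : v (i - 1) < v i <;> by_cases p2 : v (j - 1) < v j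
    all_goals
      simp only [map_smul, map_zero, opT_box hr hm P hi v hv0 hv1, opT_box hr hm P hj v hv0 hv1, p1,
        p2, if_true, if_false]
      module

/-! ## Passing to the affine index by conjugation with `ω` -/

theorem opOm_mul_cancel {A B : Module.End K (Laurent K r)} (h : opOm K r m * A = opOm K r m * B) :
    A = B := by
  rw [← one_mul A, ← opOmInv_mul_opOm m, mul_assoc, h, ← mul_assoc, opOmInv_mul_opOm, one_mul]

theorem opOm_mul_opT_mul (hr : 2 ≤ r) (j : Fin r) (A : Module.End K (Laurent K r)) :
    opOm K r m * (opT m P j * A) = opT m P (j + 1) * (opOm K r m * A) := by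
  rw [← mul_assoc, opOm_mul_opT hr, mul_assoc]

theorem opT_hecke (hr : 2 ≤ r) (hm : 0 < m) (hP : IsParam m P) (j : Fin r) :
    opT m P j * opT' m P j = 1 := by
  by_cases hj : j = 0
  · have h := opT_mul_opT'_of_ne hr hm hP (j := j + 1)
      (by rw [hj, zero_add]; exact one_ne_zero_fin hr)
    apply opOm_mul_cancel (m := m)
    rw [opOm_mul_opT_mul hr, opT', mul_sub, opOm_mul_opT hr, ← Algebra.commutes, ← sub_mul,
      ← mul_assoc]
    change opT m P (j + 1) * opT' m P (j + 1) * opOm K r m = _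
    rw [h, one_mul, mul_one]
  · exact opT_mul_opT'_of_ne hr hm hP hj

/-- Multiplying on the left by the invertible ω raises every index by one. -/
theorem opT_braid_of_succ (hr : 2 ≤ r) {j : Fin r}
    (h : opT m P (j + 1) * opT m P (j + 1 + 1) * opT m P (j + 1) =
      opT m P (j + 1 + 1) * opT m P (j + 1) * opT m P (j + 1 + 1)) :
    opT m P j * opT m P (j + 1) * opT m P j = opT m P (j + 1) * opT m P j * opT m P (j + 1) := by
  apply opOm_mul_cancel (m := m)
  simp only [mul_assoc, opOm_mul_opT_mul hr, opOm_mul_opT hr] at h ⊢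
  simp only [← mul_assoc] at h ⊢
  rw [h]

theorem opT_braid (hr : 3 ≤ r) (hm : 0 < m) (hP : IsParam m P) (j : Fin r) :
    opT m P j * opT m P (j + 1) * opT m P j = opT m P (j + 1) * opT m P j * opT m P (j + 1) := by
  have hr2 : 2 ≤ r := by omega
  have n1 := one_ne_zero_fin hr2
  have n2 : (1 : Fin r) + 1 ≠ 0 := by
    intro h
    have := congrArg Fin.val h
    rw [Fin.val_add, Fin.val_one', Fin.val_zero, Nat.mod_eq_of_lt (a := 1) (by omega),
      Nat.mod_eq_of_lt (by omega)] at this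
    omega
  -- Two adjacent pairs contain the index 0. The pair (0, 1) reduces to the finite pair (1, 2), and
  -- then the pair (r - 1, 0) reduces to (0, 1).
  have h0 : opT m P 0 * opT m P (0 + 1) * opT m P 0 =
      opT m P (0 + 1) * opT m P 0 * opT m P (0 + 1) :=
    opT_braid_of_succ hr2 (by rw [zero_add]; exact opT_braid_of_ne hr hm hP n1 n2)
  by_cases hj : j = 0
  · rw [hj]; exact h0
  by_cases hj' : j + 1 = 0
  · exact opT_braid_of_succ hr2 (by rw [hj']; exact h0)
  · exact opT_braid_of_ne hr hm hP hj hj'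

/-- If one index is 0, non-adjacency keeps the other from being r - 1, so raising both by one makes
both finite. -/
theorem opT_comm (hr : 2 ≤ r) (hm : 0 < m) (hP : IsParam m P) {i j : Fin r} (hij : i ≠ j)
    (h1 : i ≠ j + 1) (h2 : j ≠ i + 1) : opT m P i * opT m P j = opT m P j * opT m P i := by
  by_cases h0 : i ≠ 0 ∧ j ≠ 0
  · exact opT_comm_of_ne hr hm hP h0.1 h0.2 hij h1 h2
  have hi : i + 1 ≠ 0 := by
    intro h
    by_cases hj : j = 0
    · exact h2 (hj.trans h.symm)
    · refine one_ne_zero_fin hr ?_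
      rwa [show i = 0 by tauto, zero_add] at h
  have hj : j + 1 ≠ 0 := by
    intro h
    by_cases hi : i = 0
    · exact h1 (hi.trans h.symm)
    · refine one_ne_zero_fin hr ?_
      rwa [show j = 0 by tauto, zero_add] at h
  have h := opT_comm_of_ne hr hm hP hi hj (by simpa using hij) (by simpa using h1)
    (by simpa using h2)
  apply opOm_mul_cancel (m := m)
  rw [opOm_mul_opT_mul hr, opOm_mul_opT hr, opOm_mul_opT_mul hr, opOm_mul_opT hr, ← mul_assoc, h,
    mul_assoc]

end Relations

/-! ## The representation parameters -/

theorem gPar_congr {n : ℕ} (e : ℤˣ) {a b : ℤ} (h : (n : ℤ) ∣ a - b) :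
    gPar n e a = gPar n e b := by
  rw [gPar, gPar, Int.emod_eq_emod_iff_emod_sub_eq_zero.2 (Int.emod_eq_zero_of_dvd h)]

theorem gPar_zero (n : ℕ) (e : ℤˣ) : gPar n e 0 = -1 := by simp [gPar, gNat]

theorem gVar_ne_zero {n : ℕ} (i : {i : ℕ // 0 < i ∧ 2 * i < n}) : gVar i ≠ 0 := by
  unfold gVar
  rw [Ne, IsFractionRing.to_map_eq_zero_iff]
  exact MvPolynomial.X_ne_zero i

theorem gNat_mul_gNat_sub_of_lt {n : ℕ} (e : ℤˣ) {j : ℕ} (hj : 0 < j) (hjn : 2 * j < n) :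
    gNat n e j * gNat n e (n - j) = algebraMap BaseField (ParamField n) (kVar ^ (-2 : ℤ)) := by
  have h : 0 < n - (n - j) ∧ 2 * (n - (n - j)) < n := by omega
  have e1 : gNat n e j = gVar ⟨j, hj, hjn⟩ := by
    rw [gNat, if_neg hj.ne', if_neg hjn.ne, dif_pos ⟨hj, hjn⟩]
  have e2 : gNat n e (n - j) =
      algebraMap BaseField (ParamField n) (kVar ^ (-2 : ℤ)) * (gVar ⟨j, hj, hjn⟩)⁻¹ := by
    rw [gNat, if_neg (by omega), if_neg (by omega), dif_neg (by omega), dif_pos h]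
    congr 4
    omega
  rw [e1, e2, mul_left_comm, mul_inv_cancel₀ (gVar_ne_zero _), mul_one]

theorem gNat_mul_gNat_sub {n : ℕ} (e : ℤˣ) {j : ℕ} (hj : 0 < j) (hjn : j < n) :
    gNat n e j * gNat n e (n - j) = algebraMap BaseField (ParamField n) (kVar ^ (-2 : ℤ)) := by
  rcases lt_trichotomy (2 * j) n with h | h | h
  · exact gNat_mul_gNat_sub_of_lt e hj h
  -- At j = n/2 the two factors coincide, and the sign disappears on squaring.
  · rw [show n - j = j by omega, gNat, if_neg hj.ne', if_pos h, ← map_mul]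
    congr 1
    have he : (((e : ℤ) : BaseField))⁻¹ * (((e : ℤ) : BaseField))⁻¹ = 1 := by
      rcases Int.units_eq_one_or e with rfl | rfl <;> simp
    rw [mul_mul_mul_comm, he, one_mul, zpow_neg, ← mul_inv]
    congr 1
    exact (pow_two _).symm
  · have := gNat_mul_gNat_sub_of_lt (n := n) e (j := n - j) (by omega) (by omega)
    rwa [show n - (n - j) = j by omega, mul_comm] at this

theorem gPar_mul_gPar_neg {n : ℕ} (hn : 0 < n) (e : ℤˣ) {s : ℤ} (hs : ¬ (n : ℤ) ∣ s) :
    gPar n e s * gPar n e (-s) = algebraMap BaseField (ParamField n) (kVar ^ (-2 : ℤ)) := by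
  have hn' : (0 : ℤ) < n := by exact_mod_cast hn
  have h1 := Int.emod_lt_of_pos s hn'
  have h2 : 0 < s % n := lt_of_le_of_ne (Int.emod_nonneg _ hn'.ne')
    fun h => hs (Int.dvd_of_emod_eq_zero h.symm)
  obtain ⟨j, hj⟩ := Int.eq_ofNat_of_zero_le h2.le
  rw [hj] at h1 h2
  have h3 : (-s) % (n : ℤ) = ((n - j : ℕ) : ℤ) := by
    have h4 := Int.mul_ediv_add_emod s n
    rw [Nat.cast_sub (by omega), ← hj, show -s = (n - s % n : ℤ) + n * (-(s / n) - 1) by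
      linear_combination h4, Int.add_mul_emod_self_left, Int.emod_eq_of_lt] <;> omega
  rw [gPar, gPar, hj, h3, Int.toNat_natCast]
  exact gNat_mul_gNat_sub e (by omega) (by omega)

namespace MetaplecticData

variable {r : ℕ} [NeZero r]

/-- By Bézout κ' is an integral combination of n and κ, so n divides κ's whenever it divides κs.
This is why the n-periodic g yields parameters of period m. -/
theorem n_dvd_kappa_mul_iff (D : MetaplecticData r) (s : ℤ) :
    (D.n : ℤ) ∣ D.kappa * s ↔ (D.m : ℤ) ∣ s := by
  have hn : (D.kappa' : ℤ) * D.m = D.n := by exact_mod_cast D.kappa'_mul_m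
  constructor
  · intro h
    have hb : (D.kappa' : ℤ) = _ := Int.gcd_eq_gcd_ab D.n D.kappa
    have : (D.n : ℤ) ∣ D.kappa' * s := by
      rw [hb, add_mul]
      refine dvd_add ((dvd_mul_right _ _).mul_right _) ?_
      rw [mul_right_comm]
      exact h.mul_right _
    rw [← hn] at this
    exact (mul_dvd_mul_iff_left (by exact_mod_cast D.kappa'_pos.ne')).1 this
  · intro h
    rw [← hn]
    exact mul_dvd_mul (Int.gcd_dvd_right _ _) h

/-- The function `P` with `p_j(λ) = P((λ, α_j))`. -/
def param (D : MetaplecticData r) (e : ℤˣ) (s : ℤ) : D.Coeff e :=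
  ⟨-(algebraMap BaseField (ParamField D.n) kVar * gPar D.n e (D.kappa * -s)),
    neg_mem (mul_mem (IntermediateField.algebraMap_mem _ _) (D.gPar_mem e _))⟩

theorem coeff_ext (D : MetaplecticData r) (e : ℤˣ) {x y : D.Coeff e} (h : x.1 = y.1) : x = y :=
  Subtype.ext h

theorem isParam_param (D : MetaplecticData r) (e : ℤˣ) : IsParam D.m (D.param e) where
  periodic s u := by
    apply D.coeff_ext
    change -(_ * gPar D.n e _) = -(_ * gPar D.n e _)
    congr 2
    apply gPar_congr
    rw [show D.kappa * -(s + D.m * u) - D.kappa * -s = D.kappa * (D.m * -u) by ring,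
      n_dvd_kappa_mul_iff]
    exact dvd_mul_right _ _
  zero := by
    apply D.coeff_ext
    change -(_ * gPar D.n e (D.kappa * -0)) = algebraMap BaseField (ParamField D.n) kVar
    rw [neg_zero, mul_zero, gPar_zero, mul_neg_one, neg_neg]
  mul_neg s hs := by
    apply D.coeff_ext
    change -(_ * gPar D.n e (D.kappa * -s)) * -(_ * gPar D.n e (D.kappa * - -s)) = 1
    have h : ¬ (D.n : ℤ) ∣ D.kappa * -s := by rwa [n_dvd_kappa_mul_iff, dvd_neg]
    rw [mul_neg D.kappa (-s), neg_mul_neg, mul_mul_mul_comm, gPar_mul_gPar_neg D.n_pos e h,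
      ← map_mul, ← map_mul, zpow_neg, zpow_ofNat, ← pow_two,
      mul_inv_cancel₀ (pow_ne_zero _ kVar_ne_zero), map_one]

/-- The opposite signs in the definitions of p_0 and p_i disappear because the gradient of the
affine root is -θ. -/
theorem p_eq_param (D : MetaplecticData r) (hr : 2 ≤ r) (e : ℤˣ) (j : Fin r) (v : Fin r → ℤ) :
    D.p hr e j v = D.param e (v ⬝ᵥ gradRoot j) := by
  apply D.coeff_ext
  change D.pVal e j v = -(_ * gPar D.n e _)
  have hne := sub_one_ne hr j
  unfold pVal
  split_ifs with h
  · subst h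
    have : theta r = eps 0 - eps (0 - 1) := by rw [theta, lastIdx_eq]
    rw [this, D.B_root v hne.symm, Int.floor_intCast, gradRoot_eq_sub, ← neg_sub (eps (0 - 1)),
      dotProduct_neg]
  · rw [D.B_root v hne, Int.floor_intCast, gradRoot_eq_sub, mul_neg]

end MetaplecticData

/-! ## The basic representation -/

section Representation

variable {K : Type} [Field K] [Algebra BaseField K] {r : ℕ} [NeZero r] {m : ℕ} {P : ℤ → K}

/-- The operators by which the generators act. -/
def opGen (P : ℤ → K) : Gen r m → Module.End K (Laurent K r)
  | .T j => opT m P j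
  | .om => opOm K r m
  | .omInv => opOmInv K r m
  | .X f => opX K r m f

theorem opGen_rel (hr : 2 ≤ r) (hm : 0 < m) (hP : IsParam m P) ⦃a b : FreeDAHA r m⦄
    (h : Rel r m a b) :
    FreeAlgebra.lift BaseField (opGen (r := r) (m := m) P) a =
      FreeAlgebra.lift BaseField (opGen P) b := by
  cases h with
  | X_scalar c => simp only [FreeAlgebra.lift_ι_apply, AlgHom.commutes, opGen]
  | X_add f g => simp [opGen]
  | X_mul f g => simp [opGen]
  | braid j h3 => simpa [opGen] using opT_braid h3 hm hP j
  | comm i j hij h1 h2 => simpa [opGen] using opT_comm hr hm hP hij h1 h2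
  | hecke j =>
    have h := opT_hecke hr hm hP j
    simp only [map_mul, map_sub, map_add, FreeAlgebra.lift_ι_apply, AlgHom.commutes, map_zero,
      opGen]
    -- Since k k⁻¹ = 1, the product (T - k)(T + k⁻¹) equals T (T - (k - k⁻¹)) - 1.
    have hk : algebraMap BaseField (Module.End K (Laurent K r)) kVar *
        algebraMap BaseField _ kVar⁻¹ = 1 := by
      rw [← map_mul, mul_inv_cancel₀ kVar_ne_zero, map_one]
    rw [opT', mul_sub, ← Algebra.commutes, map_sub, sub_mul] at h
    rw [sub_mul, mul_add, mul_add, hk, ← Algebra.commutes, ← h]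
    abel
  | om_omInv => simpa [opGen] using opOm_mul_opOmInv m
  | omInv_om => simpa [opGen] using opOmInv_mul_opOm m
  | om_T j => simpa [opGen] using opOm_mul_opT hr m P j
  | cross_T j v =>
    simp only [map_mul, map_sub, map_smul, FreeAlgebra.lift_ι_apply, opGen]
    exact opT_mul_opX hr hm P hP.periodic j v
  | cross_om v =>
    simp only [map_mul, FreeAlgebra.lift_ι_apply, opGen]
    exact opOm_mul_opX m _ v.2

/-- The metaplectic basic representation. -/
def basicRep (hr : 2 ≤ r) (hm : 0 < m) (hP : IsParam m P) :
    DAHA r m →ₐ[BaseField] Module.End K (Laurent K r) :=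
  RingQuot.liftAlgHom BaseField ⟨FreeAlgebra.lift BaseField (opGen P), opGen_rel hr hm hP⟩

theorem basicRep_of (hr : 2 ≤ r) (hm : 0 < m) (hP : IsParam m P) (g : Gen r m) :
    basicRep hr hm hP (DAHA.of g) = opGen P g := by
  rw [basicRep, DAHA.of, RingQuot.liftAlgHom_mkAlgHom_apply, FreeAlgebra.lift_ι_apply]

theorem DAHA.of_rel {a b : FreeDAHA r m} (h : Rel r m a b) :
    RingQuot.mkAlgHom BaseField (Rel r m) a = RingQuot.mkAlgHom BaseField (Rel r m) b :=
  RingQuot.mkAlgHom_rel BaseField h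

theorem DAHA.om_mul_omInv : DAHA.of (r := r) (m := m) .om * DAHA.of .omInv = 1 := by
  simpa [DAHA.of] using DAHA.of_rel (Rel.om_omInv (r := r) (m := m))

theorem DAHA.omInv_mul_om : DAHA.of (r := r) (m := m) .omInv * DAHA.of .om = 1 := by
  simpa [DAHA.of] using DAHA.of_rel (Rel.omInv_om (r := r) (m := m))

/-- The homomorphism `𝔽[x^{±m}] → ℍ^{(m)}`. -/
def DAHA.ofX (r m : ℕ) [NeZero r] : LaurentM r m →ₐ[BaseField] DAHA r m where
  toFun f := DAHA.of (.X f)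
  map_one' := by
    have := DAHA.of_rel (Rel.X_scalar (r := r) (m := m) 1)
    rwa [map_one, map_one, map_one] at this
  map_mul' f g := by simpa [DAHA.of] using DAHA.of_rel (Rel.X_mul (r := r) (m := m) f g)
  map_zero' := by
    have := DAHA.of_rel (Rel.X_scalar (r := r) (m := m) 0)
    rwa [map_zero, map_zero, map_zero] at this
  map_add' f g := by simpa [DAHA.of] using DAHA.of_rel (Rel.X_add (r := r) (m := m) f g)
  commutes' c := by
    simpa only [AlgHom.commutes, DAHA.of] using DAHA.of_rel (Rel.X_scalar (r := r) (m := m) c)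

/-- A homomorphism out of `ℍ^{(m)}` is determined by the images of `T_j`, `ω` and `x^μ`. -/
theorem DAHA.algHom_ext {A : Type*} [Ring A] [Algebra BaseField A]
    {f g : DAHA r m →ₐ[BaseField] A} (hT : ∀ j, f (DAHA.of (.T j)) = g (DAHA.of (.T j)))
    (hX : ∀ w : mLattice r m, f (DAHA.of (.X (monoM ((w : Fin r → ℤ), 0) w.2))) =
      g (DAHA.of (.X (monoM ((w : Fin r → ℤ), 0) w.2))))
    (hom : f (DAHA.of .om) = g (DAHA.of .om)) : f = g := by
  have hX' : f.comp (DAHA.ofX r m) = g.comp (DAHA.ofX r m) := by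
    refine AddMonoidAlgebra.algHom_ext (R := BaseField) (fun w => ?_)
      (Subsingleton.elim _ _)
    have := hX w
    simp only [monoM, zpow_zero] at this
    exact this
  -- No value on ω⁻¹ is prescribed; it is forced, as a left and a right inverse of the same element
  -- coincide.
  have hinv : f (DAHA.of .omInv) = g (DAHA.of .omInv) := by
    have h1 : f (DAHA.of .omInv) * f (DAHA.of .om) = 1 := by
      rw [← map_mul, DAHA.omInv_mul_om, map_one]
    have h2 : f (DAHA.of .om) * g (DAHA.of .omInv) = 1 := by
      rw [hom, ← map_mul, DAHA.om_mul_omInv, map_one]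
    exact left_inv_eq_right_inv h1 h2
  refine RingQuot.ringQuot_ext' _ _ _ (FreeAlgebra.hom_ext (funext fun x => ?_))
  cases x with
  | T j => exact hT j
  | om => exact hom
  | omInv => exact hinv
  | X p => exact DFunLike.congr_fun hX' p

end Representation

end MetaDAHA

end

theorem mainTheorem7 {r : ℕ} [NeZero r] (hr : 2 ≤ r) (D : MetaDAHA.MetaplecticData r) (e : ℤˣ) :
    ∃! π : MetaDAHA.DAHA r D.m →ₐ[MetaDAHA.BaseField]
        Module.End (D.Coeff e) (MetaDAHA.Laurent (D.Coeff e) r),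
      (∀ (j : Fin r) (v : Fin r → ℤ),
        π (MetaDAHA.DAHA.of (.T j)) (MetaDAHA.mono (D.Coeff e) (v, 0)) =
          (MetaDAHA.kVar - MetaDAHA.kVar⁻¹) • MetaDAHA.metaDiff (D.Coeff e) D.m j v +
            D.p hr e j v •
              MetaDAHA.mono (D.Coeff e) (MetaDAHA.simpleRefl D.m j (v, 0))) ∧
      (∀ (w : MetaDAHA.mLattice r D.m) (v : Fin r → ℤ),
        π (MetaDAHA.DAHA.of (.X (MetaDAHA.monoM ((w : Fin r → ℤ), 0) w.2)))
            (MetaDAHA.mono (D.Coeff e) (v, 0)) =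
          MetaDAHA.mono (D.Coeff e) (v + (w : Fin r → ℤ), 0)) ∧
      (∀ v : Fin r → ℤ,
        π (MetaDAHA.DAHA.of .om) (MetaDAHA.mono (D.Coeff e) (v, 0)) =
          MetaDAHA.mono (D.Coeff e) (MetaDAHA.omegaAct D.m (v, 0))) := by
  refine ⟨MetaDAHA.basicRep hr D.m_pos (D.isParam_param e), ⟨fun j v => ?_, fun w v => ?_,
    fun v => ?_⟩, fun π ⟨h1, h2, h3⟩ => MetaDAHA.DAHA.algHom_ext (fun j => ?_) (fun w => ?_) ?_⟩
  · rw [MetaDAHA.basicRep_of, D.p_eq_param]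
    exact MetaDAHA.lin_mono _ v
  · rw [MetaDAHA.basicRep_of]
    change MetaDAHA.opX (D.Coeff e) r D.m _ _ = _
    rw [MetaDAHA.opX_apply, MetaDAHA.embed_monoM, MetaDAHA.mono_mul, Prod.mk_add_mk, add_zero,
      add_comm]
  · rw [MetaDAHA.basicRep_of]
    exact MetaDAHA.opOm_mono _ _
  · refine MetaDAHA.hom_ext_mono fun v => ?_
    rw [h1, MetaDAHA.basicRep_of, D.p_eq_param]
    change _ = MetaDAHA.opT D.m (D.param e) j _
    rw [MetaDAHA.opT, MetaDAHA.lin_mono]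
  · refine MetaDAHA.hom_ext_mono fun v => ?_
    rw [h2, MetaDAHA.basicRep_of]
    change _ = MetaDAHA.opX (D.Coeff e) r D.m _ _
    rw [MetaDAHA.opX_apply, MetaDAHA.embed_monoM, MetaDAHA.mono_mul, Prod.mk_add_mk, add_zero,
      add_comm]
  · refine MetaDAHA.hom_ext_mono fun v => ?_
    rw [h3, MetaDAHA.basicRep_of]
    exact (MetaDAHA.opOm_mono _ _).symm
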